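/- Let $G$ be a connected (simple, possibly infinite, not necessarily countable or locally finite) graph, regarded as a 1-complex, so that every edge is a copy of the real interval $[0,1]$. For $\ell : E(G)\to\mathbb R_{>0}$, identify each edge $e$ affinely with $[0,\ell(e)]$. For points $x,y$ of $G$ let $d_\ell(x,y)$ be the infimum of the lengths of the $x$--$y$ arcs in $G$, where the length of an arc is the sum of the lengths of the edges and maximal partial edges it contains. Let $|G|_\ell$ be the completion of the metric space obtained from $(G,d_\ell)$ by identifying points at distance $0$. Two rays (one-way infinite paths) of $G$ are equivalent if for every finite $S\subseteq V(G)$ they have tails in the same component of $G-S$; the equivalence classes are the vertex-ends of $G$, and $\Omega(G)$ is the set of them. Let $\mathrm{MTOP}(G)$ be the set $G\cup\Omega(G)$ with the topology generated by the following sets: * the open subsets of the interiors of edges, each such interior being a copy of $(0,1)$; * for every vertex $v$ and every $0<\varepsilon<1$, the open star of radius $\varepsilon$ around $v$, i.e. $v$ together with all points at distance less than $\varepsilon$ from $v$ on edges at $v$, every edge having length $1$; * for every $\omega\in\Omega(G)$, every finite $S\subseteq V(G)$ and every $\varepsilon>0$, the set $\widehat C_\varepsilon(S,\omega)=C(S,\omega)\cup\Omega(S,\omega)\cup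 \mathring E_\varepsilon(S,\omega)$, where $C(S,\omega)$ is the component of $G-S$ that contains a ray of $\omega$ (as a 1-complex), $\Omega(S,\omega)$ is the set of vertex-ends that have a ray in $C(S,\omega)$, and $\mathring E_\varepsilon(S,\omega)$ is the set of inner points of edges between $S$ and $C(S,\omega)$ whose distance from the endvertex in $C(S,\omega)$ is less than $\varepsilon$, every edge having length $1$. **Theorem.** There is $\ell : E(G)\to\mathbb R_{>0}$ such that $|G|_\ell\approx\mathrm{MTOP}(G)$, i.e. such that some homeomorphism $|G|_\ell\to\mathrm{MTOP}(G)$ maps the image in $|G|_\ell$ of every point $x$ of $G$ to $x$, if and only if $\mathrm{MTOP}(G)$ is metrizable. -/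

import Mathlib

open scoped ENNReal

universe u

namespace GraphCompletion

variable {V : Type u} {G : SimpleGraph V}

/-! ### The graph as a 1-complex -/

/-- A point of the 1-complex of `G`, in barycentric coordinates: it is either a vertex (one
coordinate is `1`, all others are `0`), or an inner point of an edge `ab` (the two coordinates at
`a` and `b` are positive and add up to `1`, all others are `0`). Along an edge `ab`, the coordinate
at `a` identifies the closed edge with the real interval `[0, 1]`. -/
structure Point (G : SimpleGraph V) where
  coord : V → ℝ
  mem : (∃ a, coord a = 1 ∧ ∀ w, w ≠ a → coord w = 0) ∨
    (∃ a b, G.Adj a b ∧ 0 < coord a ∧ 0 < coord b ∧ coord a + coord b = 1 ∧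
      ∀ w, w ≠ a → w ≠ b → coord w = 0)

/-- A vertex as a point of the 1-complex. -/
noncomputable def Point.vertex (G : SimpleGraph V) (a : V) : Point G where
  coord := fun w => by classical exact if w = a then 1 else 0
  mem := Or.inl ⟨a, by simp, fun w hw => by simp [hw]⟩

/-- `x` lies on the closed edge with ends `a` and `b`. -/
def Point.OnEdge (x : Point G) (a b : V) : Prop :=
  G.Adj a b ∧ x.coord a + x.coord b = 1

/-- `x` is an inner point of the edge with ends `a` and `b`. -/
def Point.InnerOf (x : Point G) (a b : V) : Prop :=
  x.OnEdge a b ∧ 0 < x.coord a ∧ 0 < x.coord b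

/-! ### The distance `d_ℓ` and the completion `|G|_ℓ` -/

/-- The total length of the edges of a walk. -/
noncomputable def walkLength (ℓ : G.edgeSet → ℝ) : {a b : V} → G.Walk a b → ℝ≥0∞
  | _, _, .nil => 0
  | a, _, .cons (v := c) h p => ENNReal.ofReal (ℓ ⟨s(a, c), h⟩) + walkLength ℓ p

open Classical in
/-- The length of the segment between two points `x`, `y` of a common closed edge `e`, where `e` is
identified affinely with the interval `[0, ℓ e]`; it is `⊤` if no edge contains both points. The
segment from a point to itself is degenerate and has length `0`. -/
noncomputable def segmentLength (ℓ : G.edgeSet → ℝ) (x y : Point G) : ℝ≥0∞ :=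
  if x = y then 0
  else ⨅ (a : V) (b : V) (h : G.Adj a b) (_ : x.OnEdge a b) (_ : y.OnEdge a b),
    ENNReal.ofReal (|x.coord a - y.coord a| * ℓ ⟨s(a, b), h⟩)

/-- The distance `d_ℓ x y`: the infimum of the lengths of the arcs from `x` to `y` in the
1-complex. Such an arc either is a segment of one edge, or consists of a (possibly degenerate)
segment from `x` to a vertex `a`, a path of `G` from `a` to a vertex `b`, and a (possibly
degenerate) segment from `b` to `y`. It is finite if `G` is connected. -/
noncomputable def arcDist (ℓ : G.edgeSet → ℝ) (x y : Point G) : ℝ≥0∞ :=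
  segmentLength ℓ x y ⊓
    ⨅ (a : V) (b : V) (p : G.Path a b),
      segmentLength ℓ x (Point.vertex G a) + walkLength ℓ p.1 +
        segmentLength ℓ (Point.vertex G b) y

theorem walkLength_append (ℓ : G.edgeSet → ℝ) {a b c : V} (p : G.Walk a b) (q : G.Walk b c) :
    walkLength ℓ (p.append q) = walkLength ℓ p + walkLength ℓ q := by
  induction p with
  | nil => simp [walkLength]
  | cons h p ih => simp [walkLength, ih, add_assoc]

theorem walkLength_reverse (ℓ : G.edgeSet → ℝ) {a b : V} (p : G.Walk a b) :
    walkLength ℓ p.reverse = walkLength ℓ p := by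
  induction p with
  | nil => simp [walkLength]
  | @cons u v w h p ih =>
    simp only [SimpleGraph.Walk.reverse_cons, walkLength_append, ih, walkLength, add_zero]
    rw [add_comm]
    congr 4
    exact Sym2.eq_swap

theorem walkLength_bypass_le [DecidableEq V] (ℓ : G.edgeSet → ℝ) {a b : V} (p : G.Walk a b) :
    walkLength ℓ p.bypass ≤ walkLength ℓ p := by
  induction p with
  | nil => simp [SimpleGraph.Walk.bypass]
  | @cons u v w h p ih =>
    simp only [SimpleGraph.Walk.bypass]
    split_ifs with hs
    · have h1 := congrArg (walkLength ℓ) (p.bypass.take_spec hs)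
      rw [walkLength_append] at h1
      calc _ ≤ walkLength ℓ p.bypass := by rw [← h1]; exact le_add_self
        _ ≤ walkLength ℓ p := ih
        _ ≤ _ := by simp only [walkLength]; exact le_add_self
    · simp only [walkLength]
      gcongr

theorem segmentLength_self (ℓ : G.edgeSet → ℝ) (x : Point G) : segmentLength ℓ x x = 0 := by
  simp [segmentLength]

theorem segmentLength_comm (ℓ : G.edgeSet → ℝ) (x y : Point G) :
    segmentLength ℓ x y = segmentLength ℓ y x := by
  have key : ∀ x y : Point G, segmentLength ℓ x y ≤ segmentLength ℓ y x := by
    intro x y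
    by_cases hxy : x = y
    · subst hxy; exact le_rfl
    · simp only [segmentLength, hxy, Ne.symm hxy, if_false]
      refine le_iInf fun a => le_iInf fun b => le_iInf fun h => le_iInf fun hx => le_iInf fun hy => ?_
      rw [abs_sub_comm]
      exact iInf_le_of_le a (iInf_le_of_le b (iInf_le_of_le h (iInf_le_of_le hy
        (iInf_le_of_le hx le_rfl))))
  exact le_antisymm (key x y) (key y x)

theorem segmentLength_le (ℓ : G.edgeSet → ℝ) {x y : Point G} {a b : V} (h : G.Adj a b)
    (hx : x.OnEdge a b) (hy : y.OnEdge a b) :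
    segmentLength ℓ x y ≤ ENNReal.ofReal (|x.coord a - y.coord a| * ℓ ⟨s(a, b), h⟩) := by
  by_cases hxy : x = y
  · simp [segmentLength, hxy]
  · simp only [segmentLength, hxy, if_false]
    exact iInf_le_of_le a (iInf_le_of_le b (iInf_le_of_le h (iInf_le_of_le hx
      (iInf_le_of_le hy le_rfl))))

theorem Point.ext_coord {x y : Point G} (h : ∀ w, x.coord w = y.coord w) : x = y := by
  cases x; cases y; congr; exact funext h

theorem Point.eq_vertex {x : Point G} {a : V} (h1 : x.coord a = 1)
    (h0 : ∀ w, w ≠ a → x.coord w = 0) : x = Point.vertex G a := by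
  refine Point.ext_coord fun w => ?_
  by_cases hw : w = a
  · subst hw; simp [Point.vertex, h1]
  · simp [Point.vertex, hw, h0 w hw]

theorem Point.onEdge_inner {x : Point G} {a b c d : V} (ha : 0 < x.coord a) (hb : 0 < x.coord b)
    (hs : x.coord a + x.coord b = 1) (h0 : ∀ w, w ≠ a → w ≠ b → x.coord w = 0)
    (h : x.OnEdge c d) : (c = a ∧ d = b) ∨ (c = b ∧ d = a) := by
  obtain ⟨hadj, hcd⟩ := h
  have hne := hadj.ne
  by_cases h1 : c = a
  · by_cases h2 : d = b
    · exact Or.inl ⟨h1, h2⟩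
    · have := h0 d (fun h => hne (h1.trans h.symm)) h2
      subst h1; linarith
  · by_cases h2 : c = b
    · by_cases h3 : d = a
      · exact Or.inr ⟨h2, h3⟩
      · have := h0 d h3 (fun h => hne (h2.trans h.symm))
        subst h2; linarith
    · have h4 := h0 c h1 h2
      by_cases h5 : d = a
      · subst h5; linarith
      · by_cases h6 : d = b
        · subst h6; linarith
        · have := h0 d h5 h6; linarith

theorem arcDist_le_through (ℓ : G.edgeSet → ℝ) (x y : Point G) {a b : V} (p : G.Walk a b) :
    arcDist ℓ x y ≤ segmentLength ℓ x (Point.vertex G a) + walkLength ℓ p +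
      segmentLength ℓ (Point.vertex G b) y := by
  classical
  refine inf_le_right.trans ?_
  refine iInf_le_of_le a (iInf_le_of_le b (iInf_le_of_le ⟨p.bypass, p.bypass_isPath⟩ ?_))
  gcongr
  exact walkLength_bypass_le ℓ p

theorem arcDist_self (ℓ : G.edgeSet → ℝ) (x : Point G) : arcDist ℓ x x = 0 :=
  le_antisymm (inf_le_left.trans (segmentLength_self ℓ x).le) zero_le

theorem arcDist_comm (ℓ : G.edgeSet → ℝ) (x y : Point G) : arcDist ℓ x y = arcDist ℓ y x := by
  have key : ∀ x y : Point G, arcDist ℓ x y ≤ arcDist ℓ y x := by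
    intro x y
    refine le_inf (inf_le_left.trans (segmentLength_comm ℓ x y).le) ?_
    refine le_iInf fun a => le_iInf fun b => le_iInf fun p => ?_
    refine (arcDist_le_through ℓ x y p.1.reverse).trans (le_of_eq ?_)
    rw [walkLength_reverse, segmentLength_comm ℓ x, segmentLength_comm ℓ _ y]
    ring
  exact le_antisymm (key x y) (key y x)

theorem arcDist_le_segment_add (ℓ : G.edgeSet → ℝ) (x y z : Point G) :
    arcDist ℓ x z ≤ segmentLength ℓ x y + segmentLength ℓ y z := by
  rcases y.mem with ⟨a, h1, h0⟩ | ⟨a, b, hab, ha, hb, hs, h0⟩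
  · rw [Point.eq_vertex h1 h0]
    simpa [walkLength] using arcDist_le_through ℓ x z (SimpleGraph.Walk.nil : G.Walk a a)
  · refine inf_le_left.trans ?_
    by_cases hxy : x = y
    · subst hxy; exact le_add_self
    by_cases hyz : y = z
    · subst hyz; exact le_self_add
    conv_rhs => rw [segmentLength, if_neg hxy, segmentLength, if_neg hyz]
    simp only [ENNReal.iInf_add, ENNReal.add_iInf]
    refine le_iInf fun c' => le_iInf fun d' => le_iInf fun hcd' => le_iInf fun hy' =>
      le_iInf fun hz => le_iInf fun c => le_iInf fun d => le_iInf fun hcd => le_iInf fun hx =>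
      le_iInf fun hy => ?_
    have hedge : (c' = c ∧ d' = d) ∨ (c' = d ∧ d' = c) := by
      rcases Point.onEdge_inner ha hb hs h0 hy with ⟨rfl, rfl⟩ | ⟨rfl, rfl⟩ <;>
      rcases Point.onEdge_inner ha hb hs h0 hy' with ⟨rfl, rfl⟩ | ⟨rfl, rfl⟩ <;> simp
    have main : ∀ r : ℝ, ENNReal.ofReal (|x.coord c - z.coord c| * r) ≤
        ENNReal.ofReal (|x.coord c - y.coord c| * r) +
          ENNReal.ofReal (|y.coord c - z.coord c| * r) := by
      intro r
      rw [ENNReal.ofReal_mul (abs_nonneg _), ENNReal.ofReal_mul (abs_nonneg _),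
        ENNReal.ofReal_mul (abs_nonneg _), ← add_mul,
        ← ENNReal.ofReal_add (abs_nonneg _) (abs_nonneg _)]
      gcongr
      exact abs_sub_le _ _ _
    rcases hedge with ⟨rfl, rfl⟩ | ⟨rfl, rfl⟩
    · exact (segmentLength_le ℓ hcd hx hz).trans (main _)
    · have hz2 : z.OnEdge d' c' := ⟨hcd, by rw [add_comm]; exact hz.2⟩
      refine (segmentLength_le ℓ hcd hx hz2).trans ((main _).trans (le_of_eq ?_))
      have e1 : |y.coord c' - z.coord c'| = |y.coord d' - z.coord d'| := by
        rw [← abs_neg]; congr 1; linarith [hy'.2, hz.2]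
      have e2 : (⟨s(c', d'), hcd'⟩ : G.edgeSet) = ⟨s(d', c'), hcd⟩ :=
        Subtype.ext Sym2.eq_swap
      rw [e1, e2]

theorem exists_walk_of_vertices (ℓ : G.edgeSet → ℝ) (a b : V) :
    (⨅ p : G.Walk a b, walkLength ℓ p) ≤
      segmentLength ℓ (Point.vertex G a) (Point.vertex G b) := by
  by_cases hab : a = b
  · subst hab
    exact (iInf_le _ SimpleGraph.Walk.nil).trans (by simp [walkLength])
  have hne : Point.vertex G a ≠ Point.vertex G b := by
    intro h
    have := congrArg (fun x => Point.coord x a) h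
    simp [Point.vertex, hab] at this
  rw [segmentLength, if_neg hne]
  refine le_iInf fun c => le_iInf fun d => le_iInf fun hcd => le_iInf fun hx => le_iInf fun hy => ?_
  obtain ⟨_, hx⟩ := hx
  obtain ⟨_, hy⟩ := hy
  have hcd' := hcd.ne
  simp only [Point.vertex] at hx hy
  have hedge : (c = a ∧ d = b) ∨ (c = b ∧ d = a) := by
    by_cases h1 : c = a <;> by_cases h2 : d = a <;> by_cases h3 : c = b <;>
      by_cases h4 : d = b <;> simp_all
  rcases hedge with ⟨rfl, rfl⟩ | ⟨rfl, rfl⟩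
  · refine (iInf_le _ (SimpleGraph.Walk.cons hcd .nil)).trans ?_
    simp [walkLength, Point.vertex, hcd']
  · refine (iInf_le _ (SimpleGraph.Walk.cons hcd.symm .nil)).trans ?_
    simp [walkLength, Point.vertex, hcd', Sym2.eq_swap]

theorem iInf_walk_triangle (ℓ : G.edgeSet → ℝ) (a b c : V) :
    (⨅ p : G.Walk a c, walkLength ℓ p) ≤
      (⨅ p : G.Walk a b, walkLength ℓ p) + ⨅ p : G.Walk b c, walkLength ℓ p := by
  simp only [ENNReal.iInf_add, ENNReal.add_iInf]
  refine le_iInf fun p => le_iInf fun q => ?_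
  rw [← walkLength_append]
  exact iInf_le _ _

theorem iInf_walk_le_arcDist (ℓ : G.edgeSet → ℝ) (a b : V) :
    (⨅ p : G.Walk a b, walkLength ℓ p) ≤
      arcDist ℓ (Point.vertex G a) (Point.vertex G b) := by
  refine le_inf (exists_walk_of_vertices ℓ a b) ?_
  refine le_iInf fun c => le_iInf fun d => le_iInf fun p => ?_
  calc (⨅ p : G.Walk a b, walkLength ℓ p)
      ≤ ((⨅ p : G.Walk a c, walkLength ℓ p) + ⨅ p : G.Walk c d, walkLength ℓ p) +
          ⨅ p : G.Walk d b, walkLength ℓ p :=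
        (iInf_walk_triangle ℓ a d b).trans (by gcongr; exact iInf_walk_triangle ℓ a c d)
    _ ≤ _ := by
        gcongr
        · exact exists_walk_of_vertices ℓ a c
        · exact iInf_le _ p.1
        · exact exists_walk_of_vertices ℓ d b

theorem arcDist_le_segment_add_through (ℓ : G.edgeSet → ℝ) (x y z : Point G) {a b : V}
    (p : G.Walk a b) :
    arcDist ℓ x z ≤ segmentLength ℓ x y + (segmentLength ℓ y (Point.vertex G a) +
      walkLength ℓ p + segmentLength ℓ (Point.vertex G b) z) := by
  have h : arcDist ℓ x z ≤ arcDist ℓ x (Point.vertex G a) + walkLength ℓ p +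
      segmentLength ℓ (Point.vertex G b) z := by
    rw [arcDist, arcDist, ← min_add_add_right, ← min_add_add_right]
    refine le_min (arcDist_le_through ℓ x z p) ?_
    simp only [ENNReal.iInf_add]
    refine le_iInf fun c => le_iInf fun d => le_iInf fun q => ?_
    have h1 : (⨅ r : G.Walk c b, walkLength ℓ r) ≤ walkLength ℓ q.1 +
        segmentLength ℓ (Point.vertex G d) (Point.vertex G a) + walkLength ℓ p := by
      calc _ ≤ ((⨅ r : G.Walk c d, walkLength ℓ r) + ⨅ r : G.Walk d a, walkLength ℓ r) +
            ⨅ r : G.Walk a b, walkLength ℓ r :=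
          (iInf_walk_triangle ℓ c a b).trans (by gcongr; exact iInf_walk_triangle ℓ c d a)
        _ ≤ _ := by
          gcongr
          · exact iInf_le _ q.1
          · exact exists_walk_of_vertices ℓ d a
          · exact iInf_le _ p
    calc arcDist ℓ x z ≤ segmentLength ℓ x (Point.vertex G c) +
          (⨅ r : G.Walk c b, walkLength ℓ r) + segmentLength ℓ (Point.vertex G b) z := by
          simp only [ENNReal.iInf_add, ENNReal.add_iInf]
          exact le_iInf fun r => arcDist_le_through ℓ x z r
      _ ≤ segmentLength ℓ x (Point.vertex G c) + (walkLength ℓ q.1 +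
        segmentLength ℓ (Point.vertex G d) (Point.vertex G a) + walkLength ℓ p) +
          segmentLength ℓ (Point.vertex G b) z := by gcongr
      _ = _ := by ring
  refine h.trans ?_
  calc _ ≤ (segmentLength ℓ x y + segmentLength ℓ y (Point.vertex G a)) + walkLength ℓ p +
      segmentLength ℓ (Point.vertex G b) z := by
        gcongr; exact arcDist_le_segment_add ℓ x y _
    _ = _ := by ring

theorem arcDist_triangle (ℓ : G.edgeSet → ℝ) (x y z : Point G) :
    arcDist ℓ x z ≤ arcDist ℓ x y + arcDist ℓ y z := by
  have hseg : ∀ x y z : Point G, arcDist ℓ x z ≤ segmentLength ℓ x y + arcDist ℓ y z := by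
    intro x y z
    rw [arcDist.eq_1 ℓ y z, ← min_add_add_left]
    refine le_min (arcDist_le_segment_add ℓ x y z) ?_
    simp only [ENNReal.add_iInf]
    exact le_iInf fun a => le_iInf fun b => le_iInf fun p =>
      arcDist_le_segment_add_through ℓ x y z p.1
  rw [arcDist.eq_1 ℓ x y, ← min_add_add_right]
  refine le_min (hseg x y z) ?_
  simp only [ENNReal.iInf_add]
  refine le_iInf fun a => le_iInf fun b => le_iInf fun p => ?_
  have h : ∀ w, arcDist ℓ x z ≤ segmentLength ℓ x (Point.vertex G a) + walkLength ℓ p.1 + w →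
      w = arcDist ℓ (Point.vertex G b) z → arcDist ℓ x z ≤
      segmentLength ℓ x (Point.vertex G a) + walkLength ℓ p.1 +
        segmentLength ℓ (Point.vertex G b) y + arcDist ℓ y z := by
    intro w hw hwe
    refine hw.trans ?_
    rw [add_assoc _ _ (arcDist ℓ y z), hwe]
    gcongr
    exact hseg _ _ _
  refine h _ ?_ rfl
  rw [arcDist.eq_1 ℓ (Point.vertex G b) z, ← min_add_add_left]
  refine le_min (arcDist_le_through ℓ x z p.1) ?_
  simp only [ENNReal.add_iInf]
  refine le_iInf fun c => le_iInf fun d => le_iInf fun q => ?_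
  have h1 : (⨅ r : G.Walk a d, walkLength ℓ r) ≤ walkLength ℓ p.1 +
      segmentLength ℓ (Point.vertex G b) (Point.vertex G c) + walkLength ℓ q.1 := by
    calc _ ≤ ((⨅ r : G.Walk a b, walkLength ℓ r) + ⨅ r : G.Walk b c, walkLength ℓ r) +
          ⨅ r : G.Walk c d, walkLength ℓ r :=
        (iInf_walk_triangle ℓ a c d).trans (by gcongr; exact iInf_walk_triangle ℓ a b c)
      _ ≤ _ := by
        gcongr
        · exact iInf_le _ p.1
        · exact exists_walk_of_vertices ℓ b c
        · exact iInf_le _ q.1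
  calc arcDist ℓ x z ≤ segmentLength ℓ x (Point.vertex G a) +
        (⨅ r : G.Walk a d, walkLength ℓ r) + segmentLength ℓ (Point.vertex G d) z := by
        simp only [ENNReal.iInf_add, ENNReal.add_iInf]
        exact le_iInf fun r => arcDist_le_through ℓ x z r
    _ ≤ segmentLength ℓ x (Point.vertex G a) + (walkLength ℓ p.1 +
      segmentLength ℓ (Point.vertex G b) (Point.vertex G c) + walkLength ℓ q.1) +
        segmentLength ℓ (Point.vertex G d) z := by gcongr
    _ = _ := by ring

/-- The points of the 1-complex of `G`, carrying the pseudometric `d_ℓ`. -/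
def LengthSpace (_ : G.edgeSet → ℝ) : Type u := Point G

noncomputable instance (ℓ : G.edgeSet → ℝ) : PseudoEMetricSpace (LengthSpace ℓ) where
  edist x y := arcDist ℓ x y
  edist_self := arcDist_self ℓ
  edist_comm := arcDist_comm ℓ
  edist_triangle := arcDist_triangle ℓ

/-- The space `|G|_ℓ`: points at distance `0` are identified, and the resulting metric space is
completed. -/
abbrev LTop (ℓ : G.edgeSet → ℝ) : Type u :=
  UniformSpace.Completion (SeparationQuotient (LengthSpace ℓ))

/-- The canonical map from the 1-complex of `G` to `|G|_ℓ`. -/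
noncomputable def LTop.ofPoint (ℓ : G.edgeSet → ℝ) (x : Point G) : LTop ℓ :=
  ((SeparationQuotient.mk (show LengthSpace ℓ from x) : SeparationQuotient (LengthSpace ℓ)) :
    UniformSpace.Completion (SeparationQuotient (LengthSpace ℓ)))

/-! ### Vertex-ends and the space `MTOP(G)` -/

/-- A ray: a one-way infinite path. -/
structure Ray (G : SimpleGraph V) where
  vert : ℕ → V
  injective : Function.Injective vert
  adj : ∀ n, G.Adj (vert n) (vert (n + 1))

/-- The ray `R` has a tail in the set `C`. -/
def Ray.HasTailIn (R : Ray G) (C : Set V) : Prop := ∃ N, ∀ n, N ≤ n → R.vert n ∈ C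

/-- Vertex-equivalence of rays, no finite set of vertices separates them: for every finite set `S`
of vertices, both rays have a tail in the same component of `G - S`. -/
def Ray.Equivalent (R L : Ray G) : Prop :=
  ∀ S : Finset V, ∃ C : G.ComponentCompl (S : Set V),
    R.HasTailIn (C : Set V) ∧ L.HasTailIn (C : Set V)

theorem Ray.exists_tail_component (R : Ray G) (S : Finset V) :
    ∃ C : G.ComponentCompl (S : Set V), R.HasTailIn (C : Set V) := by
  have hfin : {n | R.vert n ∈ S}.Finite := S.finite_toSet.preimage R.injective.injOn
  obtain ⟨N, hN⟩ := hfin.bddAbove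
  have hout : ∀ n, N + 1 ≤ n → R.vert n ∉ (S : Set V) := by
    intro n hn hmem
    have : n ≤ N := hN hmem
    omega
  refine ⟨G.componentComplMk (hout (N + 1) le_rfl), N + 1, fun n hn => ?_⟩
  induction n, hn using Nat.le_induction with
  | base => exact SimpleGraph.componentComplMk_mem G _
  | succ n hn ih =>
    exact SimpleGraph.ComponentCompl.mem_of_adj _ _ ih (hout (n + 1) (by omega)) (R.adj n)

theorem Ray.tail_component_unique (R : Ray G) {S : Set V} {C D : G.ComponentCompl S}
    (hC : R.HasTailIn (C : Set V)) (hD : R.HasTailIn (D : Set V)) : C = D := by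
  obtain ⟨N, hN⟩ := hC
  obtain ⟨M, hM⟩ := hD
  obtain ⟨_, h1⟩ := hN (max N M) (le_max_left _ _)
  obtain ⟨_, h2⟩ := hM (max N M) (le_max_right _ _)
  exact h1.symm.trans h2

/-- Vertex-equivalence is an equivalence relation on rays. -/
instance raySetoid (G : SimpleGraph V) : Setoid (Ray G) where
  r := Ray.Equivalent
  iseqv :=
    { refl := fun R S => (R.exists_tail_component S).imp fun _ h => ⟨h, h⟩
      symm := fun h S => (h S).imp fun _ h => ⟨h.2, h.1⟩
      trans := fun {_ L _} h h' S => by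
        obtain ⟨C, h1, h2⟩ := h S
        obtain ⟨D, h3, h4⟩ := h' S
        rw [← L.tail_component_unique h2 h3] at h4
        exact ⟨C, h1, h4⟩ }

/-- The set `Ω(G)` of vertex-ends of `G`. -/
def VertexEnd (G : SimpleGraph V) : Type u := Quotient (raySetoid G)

/-- The vertex-end `ω` has a ray all of whose vertices lie in `C`. -/
def VertexEnd.HasRayIn (ω : VertexEnd G) (C : Set V) : Prop :=
  ∃ R : Ray G, Quotient.mk (raySetoid G) R = ω ∧ ∀ n, R.vert n ∈ C

/-- The vertex set of `C(S, ω)`, the unique component of `G - S` that contains a ray in `ω`. -/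
def endComponent (S : Finset V) (ω : VertexEnd G) : Set V :=
  {v | ∃ C : G.ComponentCompl (S : Set V), ω.HasRayIn (C : Set V) ∧ v ∈ C}

/-- The point set of `MTOP(G)`: the points of the 1-complex of `G` and the vertex-ends of `G`. -/
inductive MTop (G : SimpleGraph V) : Type u
  | point (x : Point G) : MTop G
  | vertexEnd (ω : VertexEnd G) : MTop G

/-- The points with coordinate in `U` of the open edge with ends `a` and `b`. -/
def MTop.edgePart (G : SimpleGraph V) (a b : V) (U : Set ℝ) : Set (MTop G) :=
  {p | ∃ x : Point G, p = .point x ∧ x.InnerOf a b ∧ x.coord a ∈ U}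

/-- The open star of radius `ε < 1` around the vertex `v`; the distance of `v` from a point `x` of
an edge at `v` is `1 - x.coord v`, every edge having length `1`. -/
def MTop.openStar (G : SimpleGraph V) (v : V) (ε : ℝ) : Set (MTop G) :=
  {p | ∃ x : Point G, p = .point x ∧ 1 - x.coord v < ε}

/-- The set `Ĉ_ε(S, ω)`. It consists of the points of the component `C(S, ω)`, of the vertex-ends
with a ray in `C(S, ω)`, and of the inner points of the edges `sc` with `s ∈ S` and `c ∈ C(S, ω)`
whose distance from `c` is less than `ε`, every edge having length `1`. -/
def MTop.endNhd (S : Finset V) (ω : VertexEnd G) (ε : ℝ) : Set (MTop G) :=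
  {p | ∃ x : Point G, p = .point x ∧ ∀ v, x.coord v ≠ 0 → v ∈ endComponent S ω} ∪
  {p | ∃ ω' : VertexEnd G, p = .vertexEnd ω' ∧ ω'.HasRayIn (endComponent S ω)} ∪
  {p | ∃ x : Point G, p = .point x ∧ ∃ s ∈ S, ∃ c ∈ endComponent S ω,
    x.InnerOf s c ∧ 1 - x.coord c < ε}

/-- The topology of `MTOP(G)`. -/
instance (G : SimpleGraph V) : TopologicalSpace (MTop G) :=
  TopologicalSpace.generateFrom
    ({A | ∃ a b : V, ∃ U : Set ℝ, IsOpen U ∧ A = MTop.edgePart G a b U} ∪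
     {A | ∃ v : V, ∃ ε : ℝ, 0 < ε ∧ ε < 1 ∧ A = MTop.openStar G v ε} ∪
     {A | ∃ (S : Finset V) (ω : VertexEnd G) (ε : ℝ), 0 < ε ∧ A = MTop.endNhd S ω ε})

/-- `X ≈_A X'`: for two spaces `X`, `X'` containing the points of `A` by means of `i` and `j`, the
identity on `A` extends to a homeomorphism between `X` and `X'`. -/
def HomeomorphicOver {A X X' : Type u} [TopologicalSpace X] [TopologicalSpace X']
    (i : A → X) (j : A → X') : Prop :=
  ∃ h : X ≃ₜ X', ∀ a, h (i a) = j a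

end GraphCompletion

/-!
A completion is a metric space, so only the construction of `ℓ` from a metric on `MTOP(G)` needs an
argument. Sorting the vertices by their distance to the set of vertex-ends exhausts `V(G)` by
countably many dispersed sets: sets that every end can be separated from by finitely many vertices.
By Jung's theorem `G` then has a normal spanning tree `T`.

Give every vertex of level `n` in `T` the height `2⁻ⁿ`, and let the length of an edge be the
difference of the heights of its ends. Then the vertices and edges above a vertex `t` have distance
at most of the order of `2⁻ⁿ` from `t`, so the rays of an end converge in `|G|_ℓ`. Conversely the
barycentric coordinates and, for every `t`, the total barycentric weight of the vertices above `t`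
are Lipschitz for `d_ℓ`, hence extend to `|G|_ℓ`. These functions detect the topology of `MTOP(G)`,
because the components left by the deletion of a finite set contain, at each of their ends, the set
of all vertices above some `t`. They also show that every point of the completion outside `G` is the
limit of a branch of `T`, that is, an end.
-/

namespace GraphCompletion

variable {V : Type u} {G : SimpleGraph V}

/-! ### Walks in a set of vertices -/

/-- `v` and `w` are joined by a walk of `G` all of whose vertices lie in `A`. -/
def Linked (G : SimpleGraph V) (A : Set V) (v w : V) : Prop :=
  ∃ p : G.Walk v w, ∀ x ∈ p.support, x ∈ A

/-- The distance from `v` to `w` in the subgraph induced by `A`; it is `0` if `v` and `w` are not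
linked in `A`. -/
noncomputable def linkDist (G : SimpleGraph V) (A : Set V) (v w : V) : ℕ :=
  sInf {n | ∃ p : G.Walk v w, (∀ x ∈ p.support, x ∈ A) ∧ p.length = n}

theorem linkDist_le_length {A : Set V} {v w : V} (p : G.Walk v w) (hp : ∀ x ∈ p.support, x ∈ A) :
    linkDist G A v w ≤ p.length :=
  Nat.sInf_le ⟨p, hp, rfl⟩

namespace Linked

variable {A B : Set V} {v w x : V}

theorem exists_walk_length_eq_linkDist (h : Linked G A v w) :
    ∃ p : G.Walk v w, (∀ x ∈ p.support, x ∈ A) ∧ p.length = linkDist G A v w :=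
  Nat.sInf_mem (s := {n | ∃ p : G.Walk v w, (∀ x ∈ p.support, x ∈ A) ∧ p.length = n})
    (h.imp' _ fun p hp => ⟨p, hp, rfl⟩)

theorem mem_right (h : Linked G A v w) : w ∈ A := by
  obtain ⟨p, hp⟩ := h
  exact hp w p.end_mem_support

theorem refl (h : v ∈ A) : Linked G A v v := ⟨.nil, by simpa using h⟩

theorem symm (h : Linked G A v w) : Linked G A w v := by
  obtain ⟨p, hp⟩ := h
  exact ⟨p.reverse, by simpa using hp⟩

theorem trans (h : Linked G A v w) (h' : Linked G A w x) : Linked G A v x := by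
  obtain ⟨p, hp⟩ := h
  obtain ⟨q, hq⟩ := h'
  refine ⟨p.append q, fun y hy => ?_⟩
  rcases SimpleGraph.Walk.mem_support_append_iff _ _ |>.1 hy with hy | hy
  exacts [hp y hy, hq y hy]

theorem mono (hAB : A ⊆ B) (h : Linked G A v w) : Linked G B v w :=
  h.imp fun _ hp y hy => hAB (hp y hy)

theorem of_adj (hv : v ∈ A) (hw : w ∈ A) (h : G.Adj v w) : Linked G A v w :=
  ⟨.cons h .nil, by simp [hv, hw]⟩

theorem of_mem_support {p : G.Walk v w} (hp : ∀ y ∈ p.support, y ∈ A) (hx : x ∈ p.support) :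
    Linked G A x w := by
  classical
  exact ⟨p.dropUntil x hx, fun y hy => hp y (p.support_dropUntil_subset_support hx hy)⟩

theorem forall_mem_support_iff (h : Linked G A v w) (p : G.Walk x w) :
    (∀ y ∈ p.support, Linked G A v y) ↔ ∀ y ∈ p.support, y ∈ A :=
  ⟨fun hp y hy => (hp y hy).mem_right, fun hp _ hy => h.trans (of_mem_support hp hy).symm⟩

theorem linked_class (h : Linked G A v w) : Linked G {x | Linked G A v x} v w := by
  obtain ⟨p, hp⟩ := h
  exact ⟨p, (forall_mem_support_iff ⟨p, hp⟩ p).2 hp⟩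

theorem linkDist_class (h : Linked G A v w) (x : V) :
    linkDist G {y | Linked G A v y} x w = linkDist G A x w := by
  simp only [linkDist, Set.mem_ofPred_eq, h.forall_mem_support_iff]

theorem exists_adj_linkDist_lt (h : Linked G A v w) (hvw : v ≠ w) :
    ∃ y, G.Adj v y ∧ Linked G (A \ {v}) y w ∧
      linkDist G (A \ {v}) y w < linkDist G A v w := by
  classical
  obtain ⟨p, hp, hlength⟩ := h.exists_walk_length_eq_linkDist
  have hA : ∀ x ∈ p.bypass.support, x ∈ A := fun x hx => hp x (p.support_bypass_subset_support hx)
  have hle := p.length_bypass_le_length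
  have hpath := p.bypass_isPath
  cases hq : p.bypass with
  | nil => exact absurd rfl hvw
  | @cons _ y _ hadj q =>
    rw [hq] at hA hle hpath
    rw [SimpleGraph.Walk.cons_isPath_iff] at hpath
    have hqA : ∀ x ∈ q.support, x ∈ A \ {v} := fun x hx =>
      ⟨hA x (List.mem_cons_of_mem _ hx), fun hxv => hpath.2 (hxv ▸ hx)⟩
    refine ⟨y, hadj, ⟨q, hqA⟩, (linkDist_le_length q hqA).trans_lt ?_⟩
    rw [SimpleGraph.Walk.length_cons] at hle
    omega

theorem mem_component {S : Set V} {C : G.ComponentCompl S} (hv : v ∈ C)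
    (h : Linked G Sᶜ v w) : w ∈ C := by
  obtain ⟨p, hp⟩ := h
  induction p with
  | nil => exact hv
  | cons h p ih =>
    simp only [SimpleGraph.Walk.support_cons, List.mem_cons, forall_eq_or_imp] at hp
    exact ih (SimpleGraph.ComponentCompl.mem_of_adj _ _ hv (hp.2 _ p.start_mem_support) h) hp.2

theorem of_walk_induce {S : Set V} {a b : S} : (G.induce S).Walk a b → Linked G S a b
  | .nil => .refl (Subtype.prop _)
  | .cons h p => (of_adj (Subtype.prop _) (Subtype.prop _) h).trans (of_walk_induce p)

theorem of_mem_component {S : Set V} {C : G.ComponentCompl S} (hv : v ∈ C) (hw : w ∈ C) :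
    Linked G Sᶜ v w := by
  obtain ⟨hv, rfl⟩ := hv
  obtain ⟨hw, h⟩ := hw
  obtain ⟨p⟩ := SimpleGraph.ConnectedComponent.exact h.symm
  exact of_walk_induce p

end Linked

/-! ### Ends -/

/-- The ray that remains when the first `N` vertices of `R` are deleted. -/
def Ray.shift (R : Ray G) (N : ℕ) : Ray G where
  vert n := R.vert (N + n)
  injective _ _ h := by simpa using R.injective h
  adj n := R.adj (N + n)

theorem Ray.mk_shift (R : Ray G) (N : ℕ) :
    Quotient.mk (raySetoid G) (R.shift N) = Quotient.mk (raySetoid G) R := by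
  refine Quotient.sound fun S => ?_
  obtain ⟨C, M, hM⟩ := R.exists_tail_component S
  exact ⟨C, ⟨M, fun n hn => hM _ (by omega)⟩, M, hM⟩

theorem Ray.HasTailIn.hasRayIn {R : Ray G} {A : Set V} (h : R.HasTailIn A) :
    VertexEnd.HasRayIn (Quotient.mk (raySetoid G) R) A := by
  obtain ⟨N, hN⟩ := h
  exact ⟨R.shift N, R.mk_shift N, fun n => hN _ (by omega)⟩

theorem Ray.HasTailIn.mono {R : Ray G} {A B : Set V} (h : R.HasTailIn A) (hAB : A ⊆ B) :
    R.HasTailIn B := by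
  obtain ⟨N, hN⟩ := h
  exact ⟨N, fun n hn => hAB (hN n hn)⟩

theorem VertexEnd.HasRayIn.mono {ω : VertexEnd G} {A B : Set V} (h : ω.HasRayIn A) (hAB : A ⊆ B) :
    ω.HasRayIn B := by
  obtain ⟨R, hR, h⟩ := h
  exact ⟨R, hR, fun n => hAB (h n)⟩

theorem endComponent_eq {S : Finset V} {ω : VertexEnd G} {C : G.ComponentCompl (S : Set V)}
    (h : ω.HasRayIn (C : Set V)) : endComponent S ω = C := by
  ext v
  refine ⟨fun ⟨D, hD, hv⟩ => ?_, fun hv => ⟨C, h, hv⟩⟩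
  obtain ⟨R, rfl, hR⟩ := h
  obtain ⟨L, hLR, hL⟩ := hD
  obtain ⟨E, hLE, hRE⟩ := Quotient.exact hLR S
  have hDE : D = E := L.tail_component_unique ⟨0, fun n _ => hL n⟩ hLE
  have hCE : C = E := R.tail_component_unique ⟨0, fun n _ => hR n⟩ hRE
  rw [hCE, ← hDE]
  exact hv

theorem exists_endComponent_eq (S : Finset V) (ω : VertexEnd G) :
    ∃ C : G.ComponentCompl (S : Set V), endComponent S ω = C ∧ ω.HasRayIn (C : Set V) := by
  induction ω using Quotient.inductionOn with
  | _ R =>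
    obtain ⟨C, hC⟩ := R.exists_tail_component S
    exact ⟨C, endComponent_eq hC.hasRayIn, hC.hasRayIn⟩

theorem hasTailIn_endComponent (S : Finset V) (R : Ray G) :
    R.HasTailIn (endComponent S (Quotient.mk (raySetoid G) R)) := by
  obtain ⟨C, hC⟩ := R.exists_tail_component S
  rw [endComponent_eq hC.hasRayIn]
  exact hC

theorem mem_endComponent_of_linked {S : Finset V} {ω : VertexEnd G} {v w : V}
    (hv : v ∈ endComponent S ω) (h : Linked G (S : Set V)ᶜ v w) : w ∈ endComponent S ω := by
  obtain ⟨C, hC, hv⟩ := hv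
  exact ⟨C, hC, h.mem_component hv⟩

theorem notMem_of_mem_endComponent {S : Finset V} {ω : VertexEnd G} {v : V}
    (hv : v ∈ endComponent S ω) : v ∉ S := by
  obtain ⟨C, -, hv⟩ := hv
  exact SimpleGraph.ComponentCompl.notMem_of_mem hv

theorem endComponent_eq_of_hasRayIn {S : Finset V} {ω ω' : VertexEnd G}
    (h : ω'.HasRayIn (endComponent S ω)) : endComponent S ω' = endComponent S ω := by
  obtain ⟨C, hC, -⟩ := exists_endComponent_eq S ω
  rw [hC] at h ⊢
  exact endComponent_eq h

theorem endComponent_anti {S T : Finset V} (hST : S ⊆ T) (ω : VertexEnd G) :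
    endComponent T ω ⊆ endComponent S ω := by
  intro v hv
  obtain ⟨C, hC, R, rfl, hR⟩ := exists_endComponent_eq T ω
  rw [hC] at hv
  obtain ⟨N, hN⟩ := hasTailIn_endComponent S R
  exact mem_endComponent_of_linked (hN N le_rfl)
    ((Linked.of_mem_component (hR N) hv).mono (by simpa using hST))

/-! ### Metrizability and dispersed sets -/

namespace MTop

theorem isOpen_edgePart (a b : V) {U : Set ℝ} (hU : IsOpen U) : IsOpen (edgePart G a b U) :=
  TopologicalSpace.isOpen_generateFrom_of_mem (.inl (.inl ⟨a, b, U, hU, rfl⟩))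

theorem isOpen_openStar (v : V) {ε : ℝ} (h0 : 0 < ε) (h1 : ε < 1) : IsOpen (openStar G v ε) :=
  TopologicalSpace.isOpen_generateFrom_of_mem (.inl (.inr ⟨v, ε, h0, h1, rfl⟩))

theorem isOpen_endNhd (S : Finset V) (ω : VertexEnd G) {ε : ℝ} (h0 : 0 < ε) :
    IsOpen (endNhd S ω ε) :=
  TopologicalSpace.isOpen_generateFrom_of_mem (.inr ⟨S, ω, ε, h0, rfl⟩)

theorem vertexEnd_notMem_edgePart {a b : V} {U : Set ℝ} {ω : VertexEnd G} :
    vertexEnd ω ∉ edgePart G a b U := by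
  rintro ⟨x, hx, -⟩
  cases hx

theorem vertexEnd_notMem_openStar {v : V} {ε : ℝ} {ω : VertexEnd G} :
    vertexEnd ω ∉ openStar G v ε := by
  rintro ⟨x, hx, -⟩
  cases hx

theorem point_mem_edgePart {a b : V} {U : Set ℝ} {x : Point G} :
    point x ∈ edgePart G a b U ↔ x.InnerOf a b ∧ x.coord a ∈ U := by
  simp [edgePart]

theorem point_mem_openStar {v : V} {ε : ℝ} {x : Point G} :
    point x ∈ openStar G v ε ↔ 1 - x.coord v < ε := by
  simp [openStar]

theorem vertexEnd_mem_endNhd {S : Finset V} {ω ω' : VertexEnd G} {ε : ℝ} :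
    vertexEnd ω' ∈ endNhd S ω ε ↔ ω'.HasRayIn (endComponent S ω) := by
  simp [endNhd]

theorem point_mem_endNhd {S : Finset V} {ω : VertexEnd G} {ε : ℝ} {x : Point G} :
    point x ∈ endNhd S ω ε ↔ (∀ v, x.coord v ≠ 0 → v ∈ endComponent S ω) ∨
      ∃ s ∈ S, ∃ c ∈ endComponent S ω, x.InnerOf s c ∧ 1 - x.coord c < ε := by
  simp [endNhd]

theorem point_vertex_mem_endNhd {S : Finset V} {ω : VertexEnd G} {ε : ℝ} {v : V}
    (hv : v ∈ endComponent S ω) : point (Point.vertex G v) ∈ endNhd S ω ε := by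
  refine point_mem_endNhd.2 (.inl fun w hw => ?_)
  obtain rfl : w = v := by
    by_contra hwv
    exact hw (by simp [Point.vertex, hwv])
  exact hv

theorem exists_endComponent_subset_of_isOpen {U : Set (MTop G)} (hU : IsOpen U) {ω : VertexEnd G}
    (hω : vertexEnd ω ∈ U) :
    ∃ S : Finset V, ∀ v ∈ endComponent S ω, point (Point.vertex G v) ∈ U := by
  classical
  induction hU with
  | basic A hA =>
    rcases hA with (⟨a, b, W, -, rfl⟩ | ⟨v, ε, -, -, rfl⟩) | ⟨S, ω', ε, -, rfl⟩
    · exact absurd hω vertexEnd_notMem_edgePart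
    · exact absurd hω vertexEnd_notMem_openStar
    · rw [vertexEnd_mem_endNhd] at hω
      exact ⟨S, fun v hv => point_vertex_mem_endNhd (endComponent_eq_of_hasRayIn hω ▸ hv)⟩
  | univ => exact ⟨∅, fun v _ => trivial⟩
  | inter A B _ _ hA hB =>
    obtain ⟨S, hS⟩ := hA hω.1
    obtain ⟨T, hT⟩ := hB hω.2
    exact ⟨S ∪ T, fun v hv => ⟨hS v (endComponent_anti Finset.subset_union_left ω hv),
      hT v (endComponent_anti Finset.subset_union_right ω hv)⟩⟩
  | sUnion 𝒜 _ h =>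
    obtain ⟨A, hA, hωA⟩ := hω
    obtain ⟨S, hS⟩ := h A hA hωA
    exact ⟨S, fun v hv => ⟨A, hA, hS v hv⟩⟩

end MTop

/-- A set of vertices is dispersed if every vertex-end can be separated from it by finitely many
vertices. -/
def Dispersed (G : SimpleGraph V) (U : Set V) : Prop :=
  ∀ ω : VertexEnd G, ∃ S : Finset V, Disjoint (endComponent S ω) U

theorem Dispersed.mono {U W : Set V} (h : Dispersed G W) (hUW : U ⊆ W) : Dispersed G U :=
  fun ω => (h ω).imp fun _ hS => hS.mono_right hUW

theorem exists_forall_dispersed_le [TopologicalSpace.MetrizableSpace (MTop G)] :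
    ∃ r : V → ℕ, ∀ k, Dispersed G {v | r v ≤ k} := by
  classical
  let _ : MetricSpace (MTop G) := TopologicalSpace.metrizableSpaceMetric (MTop G)
  have exists_le_dist (v : V) : ∃ n : ℕ, ∀ ω : VertexEnd G,
      1 / ((n : ℝ) + 1) ≤ dist (MTop.point (Point.vertex G v)) (MTop.vertexEnd ω) := by
    obtain ⟨ε, hε, hball⟩ := Metric.isOpen_iff.1
      (MTop.isOpen_openStar v one_half_pos one_half_lt_one) (MTop.point (Point.vertex G v))
      (MTop.point_mem_openStar.2 (by simp [Point.vertex]))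
    obtain ⟨n, hn⟩ := exists_nat_one_div_lt hε
    refine ⟨n, fun ω => le_of_not_gt fun hlt => ?_⟩
    exact MTop.vertexEnd_notMem_openStar (hball (Metric.mem_ball'.2 (hlt.trans hn)))
  choose r hr using exists_le_dist
  refine ⟨r, fun k ω => ?_⟩
  obtain ⟨S, hS⟩ := MTop.exists_endComponent_subset_of_isOpen
    (Metric.isOpen_ball (x := MTop.vertexEnd ω) (ε := 1 / ((k : ℝ) + 1)))
    (Metric.mem_ball_self (by positivity))
  refine ⟨S, Set.disjoint_left.2 fun v hv hvk => ?_⟩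
  have hlt := Metric.mem_ball.1 (hS v hv)
  have hle : 1 / ((k : ℝ) + 1) ≤ 1 / ((r v : ℝ) + 1) := by
    gcongr
    exact hvk
  linarith [hr v ω]

/-! ### Normal spanning trees -/

/-- A normal spanning tree of `G`, given by its tree order: the ends of every edge of `G` are
comparable, and the tree edges, which join `a` to its successor below some `b > a`, are edges of
`G`. -/
structure NormalSpanningTree (G : SimpleGraph V) where
  le : V → V → Prop
  level : V → ℕ
  root : V
  refl : ∀ a, le a a
  trans : ∀ {a b c}, le a b → le b c → le a c
  root_le : ∀ a, le root a
  level_root : level root = 0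
  level_lt : ∀ {a b}, le a b → a ≠ b → level a < level b
  chain : ∀ {a b c}, le a c → le b c → le a b ∨ le b a
  le_or_le_of_adj : ∀ {a b}, G.Adj a b → le a b ∨ le b a
  exists_child : ∀ {a b}, le a b → a ≠ b →
    ∃ c, G.Adj a c ∧ level c = level a + 1 ∧ le a c ∧ le c b

theorem exists_wellFoundedLT_monotone {α β : Type*} [LinearOrder β] [WellFoundedLT β]
    (r : α → β) : ∃ _ : LinearOrder α, WellFoundedLT α ∧ Monotone r := by
  obtain ⟨_, _⟩ := exists_wellFoundedLT α
  let f : α → β ×ₗ α := fun a => toLex (r a, a)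
  have hf : Function.Injective f := fun a b hab => congrArg (fun c => (ofLex c).2) hab
  exact ⟨LinearOrder.lift' f hf, ⟨InvImage.wf f wellFounded_lt⟩,
    fun _ _ hab => Prod.Lex.monotone_fst _ _ hab⟩

theorem csInf_eq_of_subset_of_mem {α : Type*} [ConditionallyCompleteLinearOrderBot α]
    {s t : Set α} (hst : s ⊆ t) (ht : sInf t ∈ s) : sInf s = sInf t :=
  le_antisymm (csInf_le' ht) (csInf_le_csInf (OrderBot.bddBelow t) ⟨_, ht⟩ hst)

theorem eventually_forall_mem_succ_of_antitone {α : Type*} {A : ℕ → Set α} (hA : Antitone A)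
    (S : Finset α) : ∀ᶠ n in Filter.atTop, ∀ a ∈ S, a ∈ A n → a ∈ A (n + 1) := by
  refine (Filter.eventually_all_finset S).2 fun a _ => ?_
  by_cases ha : ∀ n, a ∈ A n
  · exact .of_forall fun n _ => ha (n + 1)
  · push Not at ha
    obtain ⟨n, hn⟩ := ha
    exact Filter.eventually_atTop.2 ⟨n, fun m hm ham => absurd (hA hm ham) hn⟩

section Search

variable [ConditionallyCompleteLinearOrderBot V]

open Classical in
/-- A neighbour of `t` in `C` that is as close as possible to the least element of `C`, distances
being measured inside `C`. If `t` has no neighbour in `C`, the value is `t`. -/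
noncomputable def closestNeighbor (G : SimpleGraph V) (C : Set V) (t : V) : V :=
  if h : {y ∈ C | G.Adj t y}.Nonempty then
    Function.argminOn (fun y => linkDist G C y (sInf C)) {y ∈ C | G.Adj t y} h
  else t

theorem closestNeighbor_mem {C : Set V} {t : V} (h : ∃ y ∈ C, G.Adj t y) :
    closestNeighbor G C t ∈ C ∧ G.Adj t (closestNeighbor G C t) := by
  have h' : {y ∈ C | G.Adj t y}.Nonempty := h
  rw [closestNeighbor, dif_pos h']
  exact Function.argminOn_mem _ _ h'

theorem linkDist_closestNeighbor_le {C : Set V} {t y : V} (hy : y ∈ C) (hty : G.Adj t y) :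
    linkDist G C (closestNeighbor G C t) (sInf C) ≤ linkDist G C y (sInf C) := by
  have hmem : y ∈ {y ∈ C | G.Adj t y} := ⟨hy, hty⟩
  rw [closestNeighbor, dif_pos ⟨y, hmem⟩]
  exact Function.argminOn_le (fun y => linkDist G C y (sInf C)) _ hmem

/-- The state (tip and region) of the search for `v` after a given number of steps. The search
starts with tip `⊥` in the whole graph; each step deletes the tip, passes to the component of the
region that contains `v`, and moves to a neighbour of the old tip there. Once `v` has been deleted
the region is empty. -/
noncomputable def searchState (G : SimpleGraph V) (v : V) : ℕ → V × Set V
  | 0 => (⊥, Set.univ)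
  | n + 1 =>
    let C := {w | Linked G ((searchState G v n).2 \ {(searchState G v n).1}) v w}
    (closestNeighbor G C (searchState G v n).1, C)

/-- The current vertex in the search for `v`. -/
noncomputable def searchTip (G : SimpleGraph V) (v : V) (n : ℕ) : V := (searchState G v n).1

/-- The set of vertices to which the search for `v` has been confined. -/
noncomputable def searchRegion (G : SimpleGraph V) (v : V) (n : ℕ) : Set V := (searchState G v n).2

theorem searchRegion_succ (v : V) (n : ℕ) : searchRegion G v (n + 1) =
    {w | Linked G (searchRegion G v n \ {searchTip G v n}) v w} :=
  rfl

theorem searchRegion_succ_subset (v : V) (n : ℕ) :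
    searchRegion G v (n + 1) ⊆ searchRegion G v n \ {searchTip G v n} :=
  fun _ hw => hw.mem_right

theorem searchRegion_antitone (v : V) : Antitone (searchRegion G v) :=
  antitone_nat_of_succ_le fun n => (searchRegion_succ_subset v n).trans Set.sdiff_subset

theorem searchTip_notMem_searchRegion {v : V} {m n : ℕ} (h : m < n) :
    searchTip G v m ∉ searchRegion G v n :=
  fun hmem => (searchRegion_succ_subset v m (searchRegion_antitone v h hmem)).2 rfl

theorem searchState_eq_of_mem {v w : V} {n : ℕ} (h : w ∈ searchRegion G v n) :
    searchState G w n = searchState G v n := by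
  induction n with
  | zero => rfl
  | succ n ih =>
    have hstate := ih (searchRegion_succ_subset v n h).1
    have hclass : {x | Linked G ((searchState G v n).2 \ {(searchState G v n).1}) w x} =
        {x | Linked G ((searchState G v n).2 \ {(searchState G v n).1}) v x} :=
      Set.ext fun x => ⟨h.trans, h.symm.trans⟩
    simp only [searchState, hstate, hclass]

theorem searchRegion_eq_of_mem {v w : V} {n : ℕ} (h : w ∈ searchRegion G v n) :
    searchRegion G w n = searchRegion G v n :=
  congrArg Prod.snd (searchState_eq_of_mem h)

theorem searchTip_eq_of_mem {v w : V} {n : ℕ} (h : w ∈ searchRegion G v n) :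
    searchTip G w n = searchTip G v n :=
  congrArg Prod.fst (searchState_eq_of_mem h)

theorem mem_searchRegion_of_forall_ne {v : V} {n : ℕ} (h : ∀ m < n, searchTip G v m ≠ v) :
    v ∈ searchRegion G v n := by
  induction n with
  | zero => trivial
  | succ n ih =>
    exact .refl ⟨ih fun m hm => h m (hm.trans n.lt_succ_self), (h n n.lt_succ_self).symm⟩

theorem linked_searchRegion (hG : G.Connected) {v x y : V} {n : ℕ}
    (hx : x ∈ searchRegion G v n) (hy : y ∈ searchRegion G v n) :
    Linked G (searchRegion G v n) x y := by
  cases n with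
  | zero =>
    obtain ⟨p⟩ := hG.preconnected x y
    exact ⟨p, fun _ _ => trivial⟩
  | succ n => exact (Linked.linked_class hx).symm.trans (Linked.linked_class hy)

theorem exists_adj_searchTip (hG : G.Connected) {v w : V} {n : ℕ}
    (htip : searchTip G v n ∈ searchRegion G v n) (hw : w ∈ searchRegion G v (n + 1)) :
    ∃ y ∈ searchRegion G v (n + 1), G.Adj (searchTip G v n) y ∧
      linkDist G (searchRegion G v (n + 1)) y w <
        linkDist G (searchRegion G v n) (searchTip G v n) w := by
  obtain ⟨hwn, hne⟩ := searchRegion_succ_subset v n hw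
  obtain ⟨y, hadj, hyw, hlt⟩ :=
    (linked_searchRegion hG htip hwn).exists_adj_linkDist_lt (Ne.symm hne)
  refine ⟨y, Linked.trans hw hyw.symm, hadj, ?_⟩
  rwa [searchRegion_succ, Linked.linkDist_class (searchRegion_succ v n ▸ hw :)]

theorem searchTip_mem_searchRegion (hG : G.Connected) {v : V} {n : ℕ}
    (hv : v ∈ searchRegion G v n) : searchTip G v n ∈ searchRegion G v n := by
  induction n with
  | zero => trivial
  | succ n ih =>
    obtain ⟨y, hy, hadj, -⟩ := exists_adj_searchTip hG (ih (searchRegion_succ_subset v n hv).1) hv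
    exact (closestNeighbor_mem ⟨y, hy, hadj⟩).1

theorem adj_searchTip_succ (hG : G.Connected) {v : V} {n : ℕ}
    (hv : v ∈ searchRegion G v (n + 1)) :
    G.Adj (searchTip G v n) (searchTip G v (n + 1)) := by
  have htip := searchTip_mem_searchRegion hG (searchRegion_succ_subset v n hv).1
  obtain ⟨y, hy, hadj, -⟩ := exists_adj_searchTip hG htip hv
  exact (closestNeighbor_mem ⟨y, hy, hadj⟩).2

theorem linkDist_searchTip_succ_lt (hG : G.Connected) {v : V} {n : ℕ}
    (htip : searchTip G v n ∈ searchRegion G v n)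
    (htarget : sInf (searchRegion G v n) ∈ searchRegion G v (n + 1)) :
    linkDist G (searchRegion G v (n + 1)) (searchTip G v (n + 1))
        (sInf (searchRegion G v (n + 1))) <
      linkDist G (searchRegion G v n) (searchTip G v n) (sInf (searchRegion G v n)) := by
  obtain ⟨y, hy, hadj, hlt⟩ := exists_adj_searchTip hG htip htarget
  have hsInf := csInf_eq_of_subset_of_mem (searchRegion_antitone v n.le_succ) htarget
  rw [← hsInf] at hlt ⊢
  exact (linkDist_closestNeighbor_le hy hadj).trans_lt (hsInf ▸ hlt)

theorem exists_sInf_searchRegion_notMem (hG : G.Connected) {v : V}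
    (hv : ∀ n, v ∈ searchRegion G v n) (N : ℕ) :
    ∃ n ≥ N, sInf (searchRegion G v n) ∉ searchRegion G v (n + 1) := by
  by_contra! hcon
  refine not_strictAnti_of_wellFoundedLT (fun k => linkDist G (searchRegion G v (N + k))
    (searchTip G v (N + k)) (sInf (searchRegion G v (N + k)))) (strictAnti_nat_of_succ_lt ?_)
  exact fun k => linkDist_searchTip_succ_lt hG (searchTip_mem_searchRegion hG (hv _))
    (hcon _ (N.le_add_right k))

/-- The ray traced by the tips of a search that never deletes its goal `v`. -/
noncomputable def searchRay (hG : G.Connected) {v : V} (hv : ∀ n, v ∈ searchRegion G v n) :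
    Ray G where
  vert := searchTip G v
  injective := by
    have hne : ∀ m n, m < n → searchTip G v m ≠ searchTip G v n := fun m n hmn h =>
      searchTip_notMem_searchRegion hmn (h ▸ searchTip_mem_searchRegion hG (hv n))
    exact fun m n hmn => not_lt.1 (fun h => hne n m h hmn.symm) |>.antisymm
      (not_lt.1 fun h => hne m n h hmn)
  adj n := adj_searchTip_succ hG (hv (n + 1))

theorem linked_compl_searchTip_sInf [WellFoundedLT V] (hG : G.Connected) {v : V} {n : ℕ}
    {S : Set V} (hv : v ∈ searchRegion G v n)
    (hS : ∀ s ∈ S, s ∈ searchRegion G v n → s ∈ searchRegion G v (n + 1))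
    (hlost : sInf (searchRegion G v n) ∉ searchRegion G v (n + 1)) :
    Linked G Sᶜ (searchTip G v n) (sInf (searchRegion G v n)) := by
  have htip := searchTip_mem_searchRegion hG hv
  have htipS : searchTip G v n ∈ Sᶜ := fun h =>
    searchTip_notMem_searchRegion n.lt_succ_self (hS _ h htip)
  by_cases heq : searchTip G v n = sInf (searchRegion G v n)
  · exact heq ▸ .refl htipS
  obtain ⟨y, hadj, ⟨q, hq⟩, -⟩ :=
    (linked_searchRegion hG htip (csInf_mem ⟨v, hv⟩)).exists_adj_linkDist_lt heq
  have hqS : ∀ x ∈ q.support, x ∈ Sᶜ := fun x hx hxS =>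
    hlost (Linked.trans (hS x hxS (hq x hx).1) (Linked.of_mem_support hq hx))
  exact .trans (.of_adj htipS (hqS y q.start_mem_support) hadj) ⟨q, hqS⟩

theorem exists_searchTip_eq [WellFoundedLT V] (hG : G.Connected)
    (hdisp : ∀ v : V, Dispersed G (Set.Iic v)) (v : V) : ∃ n, searchTip G v n = v := by
  by_contra! hcon
  have hv : ∀ n, v ∈ searchRegion G v n := fun n =>
    mem_searchRegion_of_forall_ne fun m _ => hcon m
  obtain ⟨S, hS⟩ := hdisp v (Quotient.mk _ (searchRay hG hv))
  obtain ⟨N, hN⟩ := hasTailIn_endComponent S (searchRay hG hv)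
  obtain ⟨M, hM⟩ := Filter.eventually_atTop.1
    (eventually_forall_mem_succ_of_antitone (searchRegion_antitone v) S)
  obtain ⟨n, hn, hlost⟩ := exists_sInf_searchRegion_notMem hG hv (max N M)
  have htarget := mem_endComponent_of_linked (hN n ((le_max_left N M).trans hn))
    (linked_compl_searchTip_sInf hG (hv n) (hM n ((le_max_right N M).trans hn)) hlost)
  exact Set.disjoint_left.1 hS htarget (csInf_le' (hv n))

/-- The number of steps in which the search for `v` finds `v`; it is `0` if it never does. -/
noncomputable def searchLevel (G : SimpleGraph V) (v : V) : ℕ := sInf {n | searchTip G v n = v}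

section SearchOrder

variable {a b c : V}

theorem searchTip_searchLevel (h : ∃ n, searchTip G a n = a) :
    searchTip G a (searchLevel G a) = a :=
  Nat.sInf_mem h

theorem mem_searchRegion_self_iff (h : ∃ n, searchTip G a n = a) {n : ℕ} :
    a ∈ searchRegion G a n ↔ n ≤ searchLevel G a := by
  refine ⟨fun ha => ?_, fun hn => ?_⟩
  · by_contra! hlt
    exact searchTip_notMem_searchRegion hlt (by rwa [searchTip_searchLevel h])
  · exact mem_searchRegion_of_forall_ne fun m hm => Nat.notMem_of_lt_sInf (hm.trans_le hn)

theorem searchLevel_le_of_mem (hb : ∃ n, searchTip G b n = b) {n : ℕ}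
    (h : b ∈ searchRegion G a n) : n ≤ searchLevel G b :=
  (mem_searchRegion_self_iff hb).1 (searchRegion_eq_of_mem h ▸ h)

theorem mem_searchRegion_trans (hb : ∃ n, searchTip G b n = b)
    (hab : b ∈ searchRegion G a (searchLevel G a)) (hbc : c ∈ searchRegion G b (searchLevel G b)) :
    c ∈ searchRegion G a (searchLevel G a) := by
  rw [← searchRegion_eq_of_mem hab]
  exact searchRegion_antitone b (searchLevel_le_of_mem hb hab) hbc

theorem searchLevel_lt_of_mem (ha : ∃ n, searchTip G a n = a) (hb : ∃ n, searchTip G b n = b)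
    (hab : b ∈ searchRegion G a (searchLevel G a)) (hne : a ≠ b) :
    searchLevel G a < searchLevel G b := by
  refine (searchLevel_le_of_mem hb hab).lt_of_ne fun hlevel => hne ?_
  rw [← searchTip_searchLevel ha, ← searchTip_eq_of_mem hab, hlevel, searchTip_searchLevel hb]

theorem mem_searchRegion_of_searchLevel_le (hb : ∃ n, searchTip G b n = b)
    (hac : c ∈ searchRegion G a (searchLevel G a)) (hbc : c ∈ searchRegion G b (searchLevel G b))
    (hle : searchLevel G a ≤ searchLevel G b) : b ∈ searchRegion G a (searchLevel G a) := by
  rw [← searchRegion_eq_of_mem hac]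
  refine searchRegion_antitone c hle ?_
  rw [searchRegion_eq_of_mem hbc]
  exact (mem_searchRegion_self_iff hb).2 le_rfl

theorem mem_searchRegion_of_adj (ha : ∃ n, searchTip G a n = a) (hab : G.Adj a b)
    (hle : searchLevel G a ≤ searchLevel G b) :
    b ∈ searchRegion G a (searchLevel G a) := by
  suffices ∀ n ≤ searchLevel G a, b ∈ searchRegion G a n from this _ le_rfl
  intro n hn
  induction n with
  | zero => trivial
  | succ n ih =>
    have hbn := ih (Nat.le_of_succ_le hn)
    obtain ⟨han, hatip⟩ :=
      searchRegion_succ_subset a n ((mem_searchRegion_self_iff ha).2 hn)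
    refine .of_adj ⟨han, hatip⟩ ⟨hbn, fun hbtip => ?_⟩ hab
    exact Nat.notMem_of_lt_sInf (hn.trans hle) ((searchTip_eq_of_mem hbn).trans hbtip.symm)

theorem exists_adj_searchLevel_succ (hG : G.Connected) (hex : ∀ v, ∃ n, searchTip G v n = v)
    (hab : b ∈ searchRegion G a (searchLevel G a)) (hne : a ≠ b) :
    ∃ c, G.Adj a c ∧ searchLevel G c = searchLevel G a + 1 ∧
      c ∈ searchRegion G a (searchLevel G a) ∧ b ∈ searchRegion G c (searchLevel G c) := by
  have hb : b ∈ searchRegion G b (searchLevel G a + 1) :=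
    (mem_searchRegion_self_iff (hex b)).2 (searchLevel_lt_of_mem (hex a) (hex b) hab hne)
  have hc := searchTip_mem_searchRegion hG hb
  have hlevel : searchLevel G (searchTip G b (searchLevel G a + 1)) = searchLevel G a + 1 :=
    le_antisymm (Nat.sInf_le (searchTip_eq_of_mem hc)) (searchLevel_le_of_mem (hex _) hc)
  have hadj := adj_searchTip_succ hG hb
  rw [searchTip_eq_of_mem hab, searchTip_searchLevel (hex a)] at hadj
  refine ⟨_, hadj, hlevel, ?_, ?_⟩
  · rw [← searchRegion_eq_of_mem hab]
    exact searchRegion_antitone b (Nat.le_succ _) hc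
  · rwa [hlevel, searchRegion_eq_of_mem hc]

/-- The tree order of the search: `a` lies below `b` if the search for `b` passes through `a`, that
is, if `b` is still in the region of the search for `a` when `a` is found. -/
noncomputable def searchTree (hG : G.Connected) (hex : ∀ v, ∃ n, searchTip G v n = v) :
    NormalSpanningTree G where
  le a b := b ∈ searchRegion G a (searchLevel G a)
  level := searchLevel G
  root := ⊥
  refl a := (mem_searchRegion_self_iff (hex a)).2 le_rfl
  trans := mem_searchRegion_trans (hex _)
  root_le a := by
    rw [show searchLevel G (⊥ : V) = 0 from Nat.sInf_eq_zero.2 (.inl rfl)]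
    trivial
  level_root := Nat.sInf_eq_zero.2 (.inl rfl)
  level_lt := searchLevel_lt_of_mem (hex _) (hex _)
  chain {a b _} hac hbc := (le_total (searchLevel G a) (searchLevel G b)).imp
    (mem_searchRegion_of_searchLevel_le (hex b) hac hbc)
    (mem_searchRegion_of_searchLevel_le (hex a) hbc hac)
  le_or_le_of_adj {a b} hab := (le_total (searchLevel G a) (searchLevel G b)).imp
    (mem_searchRegion_of_adj (hex a) hab) (mem_searchRegion_of_adj (hex b) hab.symm)
  exists_child := exists_adj_searchLevel_succ hG hex

end SearchOrder

end Search

/-- Jung's theorem: the tree order comes from a search that always heads for the least remaining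
vertex in a well-order whose initial segments are dispersed. -/
theorem nonempty_normalSpanningTree (hG : G.Connected) {r : V → ℕ}
    (hr : ∀ k, Dispersed G {v | r v ≤ k}) : Nonempty (NormalSpanningTree G) := by
  have := hG.nonempty
  obtain ⟨_, _, hmono⟩ := exists_wellFoundedLT_monotone r
  let _ : OrderBot V := WellFoundedLT.toOrderBot V
  let _ := WellFoundedLT.conditionallyCompleteLinearOrderBot V
  have hdisp : ∀ v : V, Dispersed G (Set.Iic v) := fun v => (hr (r v)).mono fun _ h => hmono h
  exact ⟨searchTree hG (exists_searchTip_eq hG hdisp)⟩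

/-! ### Points of the 1-complex -/

namespace Point

theorem vertex_coord_self (a : V) : (vertex G a).coord a = 1 := by simp [vertex]

theorem vertex_coord_ne {a w : V} (h : w ≠ a) : (vertex G a).coord w = 0 := by simp [vertex, h]

theorem eq_of_vertex_coord_ne_zero {a w : V} (h : (vertex G a).coord w ≠ 0) : w = a :=
  not_imp_comm.1 vertex_coord_ne h

theorem eq_vertex_or_innerOf (x : Point G) : (∃ a, x = vertex G a) ∨ ∃ a b, x.InnerOf a b := by
  rcases x.mem with ⟨a, h1, h0⟩ | ⟨a, b, hab, ha, hb, hs, -⟩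
  · exact .inl ⟨a, eq_vertex h1 h0⟩
  · exact .inr ⟨a, b, ⟨hab, hs⟩, ha, hb⟩

theorem OnEdge.symm {x : Point G} {a b : V} (h : x.OnEdge a b) : x.OnEdge b a :=
  ⟨h.1.symm, by rw [add_comm]; exact h.2⟩

theorem InnerOf.symm {x : Point G} {a b : V} (h : x.InnerOf a b) : x.InnerOf b a :=
  ⟨h.1.symm, h.2.2, h.2.1⟩

theorem vertex_onEdge {a b : V} (h : G.Adj a b) : (vertex G a).OnEdge a b :=
  ⟨h, by rw [vertex_coord_self, vertex_coord_ne h.ne.symm, add_zero]⟩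

theorem OnEdge.coord_eq_zero {x : Point G} {a b w : V} (h : x.OnEdge a b) (ha : w ≠ a)
    (hb : w ≠ b) : x.coord w = 0 := by
  rcases x.mem with ⟨c, h1, h0⟩ | ⟨c, d, -, hc, hd, hs, h0⟩
  · refine h0 w fun hw => ?_
    subst hw
    linarith [h.2, h0 a ha.symm, h0 b hb.symm]
  · rcases onEdge_inner hc hd hs h0 h with ⟨rfl, rfl⟩ | ⟨rfl, rfl⟩
    exacts [h0 w ha hb, h0 w hb ha]

theorem OnEdge.eq_or_eq_of_coord_ne_zero {x : Point G} {a b w : V} (h : x.OnEdge a b)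
    (hw : x.coord w ≠ 0) : w = a ∨ w = b := by
  by_contra! hne
  exact hw (h.coord_eq_zero hne.1 hne.2)

theorem coord_nonneg (x : Point G) (w : V) : 0 ≤ x.coord w := by
  by_cases hw : x.coord w = 0
  · exact hw.ge
  rcases x.eq_vertex_or_innerOf with ⟨a, rfl⟩ | ⟨a, b, hab⟩
  · rw [eq_of_vertex_coord_ne_zero hw, vertex_coord_self]
    exact zero_le_one
  · rcases hab.1.eq_or_eq_of_coord_ne_zero hw with rfl | rfl
    exacts [hab.2.1.le, hab.2.2.le]

theorem eq_vertex_or_exists_innerOf_of_pos {x : Point G} {v : V} (h : 0 < x.coord v) :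
    x = vertex G v ∨ ∃ w, x.InnerOf v w := by
  rcases x.eq_vertex_or_innerOf with ⟨a, rfl⟩ | ⟨a, b, hab⟩
  · exact .inl (by rw [eq_of_vertex_coord_ne_zero h.ne'])
  · rcases hab.1.eq_or_eq_of_coord_ne_zero h.ne' with rfl | rfl
    exacts [.inr ⟨b, hab⟩, .inr ⟨a, hab.symm⟩]

theorem innerOf_of_pos {x : Point G} {a b : V} (hab : a ≠ b) (ha : 0 < x.coord a)
    (hb : 0 < x.coord b) : x.InnerOf a b := by
  rcases eq_vertex_or_exists_innerOf_of_pos ha with rfl | ⟨c, hc⟩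
  · exact absurd (vertex_coord_ne hab.symm) hb.ne'
  · rcases hc.1.eq_or_eq_of_coord_ne_zero hb.ne' with rfl | rfl
    exacts [absurd rfl hab, hc]

theorem exists_innerOf {a b : V} (hab : G.Adj a b) {c : ℝ} (h0 : 0 < c) (h1 : c < 1) :
    ∃ x : Point G, x.InnerOf a b ∧ x.coord a = c := by
  classical
  let f : V → ℝ := fun w => if w = a then c else if w = b then 1 - c else 0
  have ha : f a = c := if_pos rfl
  have hb : f b = 1 - c := by simp [f, hab.ne.symm]
  have hpos : 0 < f a ∧ 0 < f b := ⟨by linarith, by linarith⟩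
  have hsum : f a + f b = 1 := by linarith
  exact ⟨⟨f, .inr ⟨a, b, hab, hpos.1, hpos.2, hsum, fun w hwa hwb => by simp [f, hwa, hwb]⟩⟩,
    ⟨⟨hab, hsum⟩, hpos⟩, ha⟩

theorem finite_support (x : Point G) : (Function.support x.coord).Finite := by
  rcases x.eq_vertex_or_innerOf with ⟨c, rfl⟩ | ⟨c, d, h⟩
  · exact (Set.finite_singleton c).subset fun w => eq_of_vertex_coord_ne_zero
  · exact (Set.toFinite {c, d}).subset fun w => h.1.eq_or_eq_of_coord_ne_zero

/-- The mass that `x` gives to `A`: the sum of its barycentric coordinates in `A`. -/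
noncomputable def mass (A : Set V) (x : Point G) : ℝ := ∑ᶠ w, A.indicator x.coord w

theorem finite_support_indicator (A : Set V) (x : Point G) :
    (Function.support (A.indicator x.coord)).Finite :=
  x.finite_support.subset (Set.support_indicator.trans_subset Set.inter_subset_right)

theorem mass_vertex (A : Set V) (a : V) : mass A (vertex G a) = A.indicator 1 a := by
  rw [mass, finsum_eq_single _ a]
  · by_cases h : a ∈ A <;> simp [h, vertex_coord_self]
  · intro w hw
    by_cases h : w ∈ A <;> simp [h, vertex_coord_ne hw]

theorem mass_of_onEdge (A : Set V) {x : Point G} {a b : V} (h : x.OnEdge a b) :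
    mass A x = A.indicator x.coord a + A.indicator x.coord b := by
  classical
  rw [mass, finsum_eq_sum_of_support_subset (s := {a, b}), Finset.sum_pair h.1.ne]
  intro w hw
  simpa using h.eq_or_eq_of_coord_ne_zero fun h0 => hw (Set.indicator_apply_eq_zero.2 fun _ => h0)

theorem mass_singleton (v : V) (x : Point G) : mass {v} x = x.coord v := by
  rw [mass, finsum_eq_single _ v fun w hw => by simp [hw]]
  simp

theorem mass_univ (x : Point G) : mass Set.univ x = 1 := by
  rcases x.eq_vertex_or_innerOf with ⟨c, rfl⟩ | ⟨c, d, h⟩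
  · simp [mass_vertex]
  · rw [mass_of_onEdge _ h.1]
    simpa using h.1.2

theorem mass_mono {A B : Set V} {x : Point G} (h : ∀ w ∈ A, 0 < x.coord w → w ∈ B) :
    mass A x ≤ mass B x := by
  refine finsum_le_finsum' (x.finite_support_indicator A) (x.finite_support_indicator B) fun w => ?_
  have hB := Set.indicator_nonneg (s := B) (fun w _ => x.coord_nonneg w) w
  by_cases hA : w ∈ A
  · rw [Set.indicator_of_mem hA]
    rcases (x.coord_nonneg w).eq_or_lt with h0 | h0
    · rwa [← h0]
    · rw [Set.indicator_of_mem (h w hA h0)]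
  · rwa [Set.indicator_of_notMem hA]

theorem mass_le_one (A : Set V) (x : Point G) : mass A x ≤ 1 :=
  (mass_mono fun w _ _ => Set.mem_univ w).trans x.mass_univ.le

theorem coord_le_one (x : Point G) (v : V) : x.coord v ≤ 1 :=
  (mass_singleton v x).ge.trans (mass_le_one _ _)

theorem coord_le_mass {A : Set V} {a : V} (ha : a ∈ A) (x : Point G) : x.coord a ≤ mass A x := by
  rw [← mass_singleton]
  exact mass_mono fun w hw _ => by rwa [Set.mem_singleton_iff.1 hw]

theorem mass_eq_one {A : Set V} {x : Point G} (h : ∀ w, x.coord w ≠ 0 → w ∈ A) : mass A x = 1 :=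
  (mass_le_one A x).antisymm (x.mass_univ.ge.trans (mass_mono fun w _ hw => h w hw.ne'))

theorem exists_coord_pos_of_mass_pos {A : Set V} {x : Point G} (h : 0 < mass A x) :
    ∃ a ∈ A, 0 < x.coord a := by
  by_contra! hA
  exact h.ne' (finsum_eq_zero_of_forall_eq_zero fun w => Set.indicator_apply_eq_zero.2 fun hw =>
    (hA w hw).antisymm (x.coord_nonneg w))

theorem mass_eq_coord_add_mass_diff {A : Set V} {a : V} (ha : a ∈ A) (x : Point G) :
    mass A x = x.coord a + mass (A \ {a}) x := by
  rw [← mass_singleton, mass, mass, mass, ← finsum_add_distrib (x.finite_support_indicator _)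
    (x.finite_support_indicator _)]
  refine finsum_congr fun w => ?_
  by_cases hw : w = a
  · simp [hw, ha]
  · by_cases hA : w ∈ A <;> simp [hw, hA]

end Point

/-! ### Lipschitz functions for the length metric -/

section Lipschitz

open NNReal

variable {ℓ : G.edgeSet → ℝ}

theorem arcDist_vertex_le_walkLength (ℓ : G.edgeSet → ℝ) {a b : V} (p : G.Walk a b) :
    arcDist ℓ (Point.vertex G a) (Point.vertex G b) ≤ walkLength ℓ p := by
  simpa [segmentLength_self] using arcDist_le_through ℓ (Point.vertex G a) (Point.vertex G b) p

theorem arcDist_le_of_onEdge {x y : Point G} {a b : V} (hx : x.OnEdge a b) (hy : y.OnEdge a b)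
    {K : ℝ} (hK : ℓ ⟨s(a, b), hx.1⟩ ≤ K) :
    arcDist ℓ x y ≤ ENNReal.ofReal (|x.coord a - y.coord a| * K) :=
  inf_le_left.trans ((segmentLength_le ℓ hx.1 hx hy).trans (by gcongr))

theorem arcDist_vertex_le_one_sub_coord (hℓ : ∀ e, ℓ e ≤ 1) {x : Point G} {v : V}
    (h : 0 < x.coord v) : arcDist ℓ x (.vertex G v) ≤ ENNReal.ofReal (1 - x.coord v) := by
  rcases Point.eq_vertex_or_exists_innerOf_of_pos h with rfl | ⟨w, hw⟩
  · simp [arcDist_self]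
  · refine (arcDist_le_of_onEdge hw.1 (Point.vertex_onEdge hw.1.1) (hℓ _)).trans_eq ?_
    rw [Point.vertex_coord_self, mul_one, abs_sub_comm, abs_of_nonneg]
    linarith [x.coord_le_one v]

theorem lipschitzWith_of_forall_onEdge {E : Type*} [PseudoEMetricSpace E] {φ : Point G → E}
    {K : ℝ≥0} (hK : K ≠ 0)
    (h : ∀ (a b : V) (hab : G.Adj a b) (x y : Point G), x.OnEdge a b → y.OnEdge a b →
      edist (φ x) (φ y) ≤ K * ENNReal.ofReal (|x.coord a - y.coord a| * ℓ ⟨s(a, b), hab⟩)) :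
    LipschitzWith K (fun x : LengthSpace ℓ => φ x) := by
  have hK0 : (K : ℝ≥0∞) ≠ 0 := ENNReal.coe_ne_zero.2 hK
  have segment (x y : Point G) : edist (φ x) (φ y) ≤ K * segmentLength ℓ x y := by
    by_cases hxy : x = y
    · simp [hxy]
    · simp only [segmentLength, if_neg hxy, ENNReal.mul_iInf_of_ne hK0 ENNReal.coe_ne_top,
        le_iInf_iff]
      exact fun a b hab hx hy => h a b hab x y hx hy
  have walk {a b : V} (p : G.Walk a b) :
      edist (φ (.vertex G a)) (φ (.vertex G b)) ≤ K * walkLength ℓ p := by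
    induction p with
    | nil => simp
    | @cons a c b hac p ih =>
      have hedge := h a c hac _ _ (Point.vertex_onEdge hac) (Point.vertex_onEdge hac.symm).symm
      rw [Point.vertex_coord_self, Point.vertex_coord_ne hac.ne, sub_zero, abs_one,
        one_mul] at hedge
      rw [walkLength, mul_add]
      exact (edist_triangle _ (φ (.vertex G c)) _).trans (add_le_add hedge ih)
  intro x y
  change _ ≤ K * arcDist ℓ x y
  simp only [arcDist, ENNReal.mul_iInf_of_ne hK0 ENNReal.coe_ne_top, mul_min, le_inf_iff,
    le_iInf_iff, mul_add]
  refine ⟨segment x y, fun a b p => ?_⟩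
  exact (edist_triangle4 _ (φ (.vertex G a)) (φ (.vertex G b)) _).trans
    (add_le_add_three (segment _ _) (walk p.1) (segment _ _))

theorem lipschitzWith_of_forall_onEdge_abs {φ : Point G → ℝ} {K : ℝ≥0} (hK : K ≠ 0)
    (h : ∀ (a b : V) (hab : G.Adj a b) (x y : Point G), x.OnEdge a b → y.OnEdge a b →
      |φ x - φ y| ≤ K * (|x.coord a - y.coord a| * ℓ ⟨s(a, b), hab⟩)) :
    LipschitzWith K (fun x : LengthSpace ℓ => φ x) :=
  lipschitzWith_of_forall_onEdge hK fun a b hab x y hx hy => by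
    rw [edist_dist, Real.dist_eq, ← ENNReal.ofReal_coe_nnreal, ← ENNReal.ofReal_mul K.coe_nonneg]
    exact ENNReal.ofReal_le_ofReal (h a b hab x y hx hy)

theorem Point.OnEdge.abs_sub_coord_comm {x y : Point G} {a b : V} (hx : x.OnEdge a b)
    (hy : y.OnEdge a b) : |x.coord b - y.coord b| = |x.coord a - y.coord a| := by
  rw [← abs_neg]
  congr 1
  linarith [hx.2, hy.2]

theorem lipschitzWith_mass {A : Set V} {K : ℝ≥0} (hK : K ≠ 0) (hℓ : ∀ e, 0 ≤ ℓ e)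
    (h : ∀ (a b : V) (hab : G.Adj a b), a ∈ A → b ∉ A → 1 ≤ K * ℓ ⟨s(a, b), hab⟩) :
    LipschitzWith K (fun x : LengthSpace ℓ => Point.mass A x) := by
  refine lipschitzWith_of_forall_onEdge_abs hK fun a b hab x y hx hy => ?_
  have hpos : 0 ≤ K * (|x.coord a - y.coord a| * ℓ ⟨s(a, b), hab⟩) :=
    mul_nonneg K.coe_nonneg (mul_nonneg (abs_nonneg _) (hℓ _))
  have hcut (hKℓ : 1 ≤ K * ℓ ⟨s(a, b), hab⟩) :
      |x.coord a - y.coord a| ≤ K * (|x.coord a - y.coord a| * ℓ ⟨s(a, b), hab⟩) := by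
    rw [mul_left_comm]
    exact le_mul_of_one_le_right (abs_nonneg _) hKℓ
  rw [Point.mass_of_onEdge A hx, Point.mass_of_onEdge A hy]
  by_cases ha : a ∈ A <;> by_cases hb : b ∈ A <;>
    simp only [ha, hb, Set.indicator_of_mem, Set.indicator_of_notMem, not_false_eq_true,
      add_zero, zero_add]
  · rwa [hx.2, hy.2, sub_self, abs_zero]
  · exact hcut (h a b hab ha hb)
  · rw [hx.abs_sub_coord_comm hy]
    refine hcut ?_
    simpa only [Sym2.eq_swap] using h b a hab.symm hb ha
  · rwa [sub_self, abs_zero]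

theorem lipschitzWith_min_coord {a b : V} (hab : G.Adj a b) {K : ℝ≥0} (hK : K ≠ 0)
    (hℓ : ∀ e, 0 ≤ ℓ e) (h : 1 ≤ K * ℓ ⟨s(a, b), hab⟩) :
    LipschitzWith K (fun x : LengthSpace ℓ => min (Point.coord x a) (Point.coord x b)) := by
  refine lipschitzWith_of_forall_onEdge_abs (φ := fun x => min (x.coord a) (x.coord b)) hK
    fun c d hcd x y hx hy => ?_
  have hpos : 0 ≤ K * (|x.coord c - y.coord c| * ℓ ⟨s(c, d), hcd⟩) :=
    mul_nonneg K.coe_nonneg (mul_nonneg (abs_nonneg _) (hℓ _))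
  have hzero (z : Point G) (hz : z.OnEdge c d) (hne : s(c, d) ≠ s(a, b)) :
      min (z.coord a) (z.coord b) = 0 := by
    refine le_antisymm (not_lt.1 fun hmin => hne ?_) (le_min (z.coord_nonneg a) (z.coord_nonneg b))
    have hab' := Point.innerOf_of_pos hab.ne (lt_min_iff.1 hmin).1 (lt_min_iff.1 hmin).2
    rcases hz.eq_or_eq_of_coord_ne_zero hab'.2.1.ne' with rfl | rfl <;>
    rcases hz.eq_or_eq_of_coord_ne_zero hab'.2.2.ne' with rfl | rfl
    exacts [absurd rfl hab.ne, rfl, Sym2.eq_swap, absurd rfl hab.ne]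
  by_cases hne : s(c, d) = s(a, b)
  · have hmin (hxy : |x.coord a - y.coord a| = |x.coord c - y.coord c| ∧
        |x.coord b - y.coord b| = |x.coord c - y.coord c|) :
        |min (x.coord a) (x.coord b) - min (y.coord a) (y.coord b)| ≤ |x.coord c - y.coord c| :=
      (abs_min_sub_min_le_max _ _ _ _).trans (max_le hxy.1.le hxy.2.le)
    rw [mul_left_comm]
    refine (hmin ?_).trans (le_mul_of_one_le_right (abs_nonneg _) (by simpa only [hne] using h))
    rcases Sym2.eq_iff.1 hne with ⟨rfl, rfl⟩ | ⟨rfl, rfl⟩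
    exacts [⟨rfl, hx.abs_sub_coord_comm hy⟩, ⟨hx.abs_sub_coord_comm hy, rfl⟩]
  · rw [hzero x hx hne, hzero y hy hne, sub_self, abs_zero]
    exact hpos

theorem walkLength_ne_top (ℓ : G.edgeSet → ℝ) {a b : V} (p : G.Walk a b) : walkLength ℓ p ≠ ⊤ := by
  induction p with
  | nil => simp [walkLength]
  | cons h p ih => simp [walkLength, ih]

theorem arcDist_ne_top (ℓ : G.edgeSet → ℝ) (hG : G.Connected) (x y : Point G) :
    arcDist ℓ x y ≠ ⊤ := by
  have near (x : Point G) : ∃ a, arcDist ℓ x (.vertex G a) ≠ ⊤ := by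
    rcases x.eq_vertex_or_innerOf with ⟨c, rfl⟩ | ⟨c, d, hcd⟩
    · exact ⟨c, by simp [arcDist_self]⟩
    · exact ⟨c, ne_top_of_le_ne_top ENNReal.ofReal_ne_top
        (arcDist_le_of_onEdge hcd.1 (Point.vertex_onEdge hcd.1.1) le_rfl)⟩
  obtain ⟨a, ha⟩ := near x
  obtain ⟨b, hb⟩ := near y
  obtain ⟨p⟩ := hG.preconnected a b
  have hab := ne_top_of_le_ne_top (walkLength_ne_top ℓ p) (arcDist_vertex_le_walkLength ℓ p)
  rw [arcDist_comm] at hb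
  exact ne_top_of_le_ne_top (ENNReal.add_ne_top.2 ⟨ENNReal.add_ne_top.2 ⟨ha, hab⟩, hb⟩)
    (edist_triangle4 (α := LengthSpace ℓ) x (.vertex G a) (.vertex G b) y)

end Lipschitz

/-! ### The completion -/

namespace LTop

variable (ℓ : G.edgeSet → ℝ)

/-- `|G|_ℓ` as a metric space. Its topology is, definitionally, the one that `LTop ℓ` already
carries. -/
@[reducible] noncomputable def metricSpace (hG : G.Connected) : MetricSpace (LTop ℓ) :=
  letI : PseudoMetricSpace (LengthSpace ℓ) :=
    PseudoEMetricSpace.toPseudoMetricSpace (arcDist_ne_top ℓ hG)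
  UniformSpace.Completion.instMetricSpace

theorem dist_ofPoint (hG : G.Connected) (x y : Point G) :
    letI := metricSpace ℓ hG
    dist (ofPoint ℓ x) (ofPoint ℓ y) = (arcDist ℓ x y).toReal :=
  letI : PseudoMetricSpace (LengthSpace ℓ) :=
    PseudoEMetricSpace.toPseudoMetricSpace (arcDist_ne_top ℓ hG)
  UniformSpace.Completion.dist_eq _ _

theorem denseRange_ofPoint : DenseRange (ofPoint ℓ) :=
  UniformSpace.Completion.denseRange_coe.comp
    (SeparationQuotient.surjective_mk (X := LengthSpace ℓ)).denseRange
    (UniformSpace.Completion.continuous_coe _)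

theorem metrizableSpace (hG : G.Connected) : TopologicalSpace.MetrizableSpace (LTop ℓ) :=
  letI := metricSpace ℓ hG
  inferInstance

variable {ℓ}

theorem subset_of_forall_ofPoint {W P : Set (LTop ℓ)} (hW : IsOpen W) (hP : IsClosed P)
    (h : ∀ x, ofPoint ℓ x ∈ W → ofPoint ℓ x ∈ P) : W ⊆ P := by
  refine ((denseRange_ofPoint ℓ).open_subset_closure_inter hW).trans (closure_minimal ?_ hP)
  rintro _ ⟨hx, x, rfl⟩
  exact h x hx

/-- The continuous extension to `|G|_ℓ` of a function on the 1-complex; it is meaningful for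
functions that are uniformly continuous for the length metric. -/
noncomputable def extend (ℓ : G.edgeSet → ℝ) (φ : Point G → ℝ) : LTop ℓ → ℝ :=
  UniformSpace.Completion.extension (SeparationQuotient.lift' fun x : LengthSpace ℓ => φ x)

theorem continuous_extend (φ : Point G → ℝ) : Continuous (extend ℓ φ) :=
  UniformSpace.Completion.continuous_extension

theorem extend_ofPoint {φ : Point G → ℝ} (hφ : UniformContinuous fun x : LengthSpace ℓ => φ x)
    (x : Point G) : extend ℓ φ (ofPoint ℓ x) = φ x :=
  (UniformSpace.Completion.extension_coe (SeparationQuotient.uniformContinuous_lift' _) _).trans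
    (SeparationQuotient.lift'_mk hφ x)

end LTop

namespace NormalSpanningTree

variable (T : NormalSpanningTree G)

/-! ### The tree order -/

/-- The vertices above `t` in the tree order. -/
def up (t : V) : Set V := {w | T.le t w}

theorem level_le {a b : V} (h : T.le a b) : T.level a ≤ T.level b := by
  by_cases hab : a = b
  · rw [hab]
  · exact (T.level_lt h hab).le

theorem eq_of_le_of_level_le {a b : V} (h : T.le a b) (hl : T.level b ≤ T.level a) : a = b :=
  by_contra fun hab => (T.level_lt h hab).not_ge hl

theorem le_of_level_le {a b c : V} (ha : T.le a c) (hb : T.le b c) (h : T.level a ≤ T.level b) :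
    T.le a b := by
  rcases T.chain ha hb with hab | hba
  · exact hab
  · rw [T.eq_of_le_of_level_le hba h]
    exact T.refl a

theorem eq_of_level_eq {a b c : V} (ha : T.le a c) (hb : T.le b c) (h : T.level a = T.level b) :
    a = b :=
  T.eq_of_le_of_level_le (T.le_of_level_le ha hb h.le) h.ge

theorem le_of_adj_of_notMem_up {a b t : V} (h : G.Adj a b) (ha : a ∈ T.up t) (hb : b ∉ T.up t) :
    T.le b t ∧ b ≠ t := by
  have hba : T.le b a := (T.le_or_le_of_adj h).resolve_left fun hab => hb (T.trans ha hab)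
  refine ⟨(T.chain ha hba).resolve_left hb, ?_⟩
  rintro rfl
  exact hb (T.refl b)

theorem adj_of_level_eq_succ {a b : V} (h : T.le a b) (hl : T.level b = T.level a + 1) :
    G.Adj a b := by
  obtain ⟨c, hac, hc, -, hcb⟩ := T.exists_child h (by rintro rfl; omega)
  rwa [← T.eq_of_le_of_level_le hcb (by omega)]

theorem exists_le_of_mass_pos {s t : V} {x : Point G} (hs : 0 < Point.mass (T.up s) x)
    (ht : 0 < Point.mass (T.up t) x) : ∃ c, T.le s c ∧ T.le t c := by
  obtain ⟨a, ha, hxa⟩ := Point.exists_coord_pos_of_mass_pos hs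
  obtain ⟨b, hb, hxb⟩ := Point.exists_coord_pos_of_mass_pos ht
  by_cases hab : a = b
  · exact ⟨a, ha, hab ▸ hb⟩
  · rcases T.le_or_le_of_adj (Point.innerOf_of_pos hab hxa hxb).1.1 with h | h
    exacts [⟨b, T.trans ha h, hb⟩, ⟨a, ha, T.trans hb h⟩]

theorem exists_child_mass_le {t : V} {x : Point G} (h : x.coord t < Point.mass (T.up t) x) :
    ∃ c, T.level c = T.level t + 1 ∧ T.le t c ∧
      Point.mass (T.up t) x ≤ x.coord t + Point.mass (T.up c) x := by
  rw [Point.mass_eq_coord_add_mass_diff (show t ∈ T.up t from T.refl t)] at h ⊢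
  obtain ⟨a, ⟨ha, hat⟩, hxa⟩ := Point.exists_coord_pos_of_mass_pos (pos_of_lt_add_right h)
  obtain ⟨c, -, hc, htc, hca⟩ := T.exists_child ha (Ne.symm hat)
  refine ⟨c, hc, htc, add_le_add le_rfl (Point.mass_mono ?_)⟩
  rintro w ⟨hw, hwt⟩ hxw
  by_cases hwa : w = a
  · rwa [hwa]
  rcases T.le_or_le_of_adj (Point.innerOf_of_pos hwa hxw hxa).1.1 with hwa | haw
  · exact T.le_of_level_le hca hwa (hc.trans_le (T.level_lt hw (Ne.symm hwt)))
  · exact T.trans hca haw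

/-! ### The edge lengths -/

/-- The height of a vertex: `2⁻ⁿ` at level `n`, so that heights decrease to `0` along branches. -/
noncomputable def height (v : V) : ℝ := (1 / 2) ^ T.level v

/-- The edge lengths for which `|G|_ℓ ≈ MTOP(G)`: the length of an edge is the difference of the
heights of its ends. -/
noncomputable def len (e : G.edgeSet) : ℝ :=
  Sym2.lift ⟨fun a b => |T.height a - T.height b|, fun _ _ => abs_sub_comm _ _⟩ e.1

theorem height_pos (v : V) : 0 < T.height v := pow_pos one_half_pos _

theorem height_le_one (v : V) : T.height v ≤ 1 := pow_le_one₀ (by norm_num) (by norm_num)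

theorem height_le_of_le {a b : V} (h : T.le a b) : T.height b ≤ T.height a :=
  pow_le_pow_of_le_one (by norm_num) (by norm_num) (T.level_le h)

theorem height_le_half {a b : V} (h : T.le a b) (hab : a ≠ b) : T.height b ≤ T.height a / 2 :=
  calc T.height b ≤ (1 / 2) ^ (T.level a + 1) :=
        pow_le_pow_of_le_one (by norm_num) (by norm_num) (T.level_lt h hab)
    _ = T.height a / 2 := by rw [pow_succ, height]; ring

theorem len_mk {a b : V} (h : G.Adj a b) : T.len ⟨s(a, b), h⟩ = |T.height a - T.height b| := rfl

theorem len_of_le {a b : V} (h : G.Adj a b) (hab : T.le a b) :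
    T.len ⟨s(a, b), h⟩ = T.height a - T.height b := by
  rw [len_mk, abs_of_nonneg (sub_nonneg.2 (T.height_le_of_le hab))]

theorem half_height_le_len {a b : V} (h : G.Adj a b) : T.height a / 2 ≤ T.len ⟨s(a, b), h⟩ := by
  have ha := T.height_pos a
  rcases T.le_or_le_of_adj h with hab | hba
  · rw [T.len_of_le h hab]
    linarith [T.height_le_half hab h.ne]
  · rw [len_mk, abs_sub_comm, ← T.len_mk h.symm, T.len_of_le h.symm hba]
    linarith [T.height_le_half hba h.ne.symm]

theorem len_pos (e : G.edgeSet) : 0 < T.len e := by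
  obtain ⟨e, he⟩ := e
  induction e using Sym2.inductionOn with
  | _ a b => exact (half_pos (T.height_pos a)).trans_le (T.half_height_le_len he)

theorem len_le_height {a b t : V} (h : G.Adj a b) (ha : a ∈ T.up t) (hb : b ∈ T.up t) :
    T.len ⟨s(a, b), h⟩ ≤ T.height t := by
  rw [len_mk, abs_le]
  constructor <;>
    linarith [T.height_le_of_le ha, T.height_le_of_le hb, T.height_pos a, T.height_pos b]

theorem len_le_one (e : G.edgeSet) : T.len e ≤ 1 := by
  obtain ⟨e, he⟩ := e
  induction e using Sym2.inductionOn with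
  | _ a b => exact (T.len_le_height he (T.root_le a) (T.root_le b)).trans (T.height_le_one _)

theorem height_le_len {a b t : V} (h : G.Adj a b) (ha : a ∈ T.up t) (hb : b ∉ T.up t) :
    T.height t ≤ T.len ⟨s(a, b), h⟩ := by
  obtain ⟨hbt, hne⟩ := T.le_of_adj_of_notMem_up h ha hb
  rw [len_mk, abs_sub_comm, ← T.len_mk h.symm, T.len_of_le h.symm (T.trans hbt ha)]
  linarith [T.height_le_half hbt hne, T.height_le_of_le ha]

theorem exists_walk {a b : V} (hab : T.le a b) : ∃ p : G.Walk a b, (∀ x ∈ p.support, x ∈ T.up a) ∧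
    walkLength T.len p ≤ ENNReal.ofReal (T.height a - T.height b) := by
  by_cases h : a = b
  · subst h
    exact ⟨.nil, by simp [up, T.refl], by simp [walkLength]⟩
  obtain ⟨c, hac, -, hac', hcb⟩ := T.exists_child hab h
  have := T.level_lt hab h
  obtain ⟨p, hp, hl⟩ := exists_walk hcb
  refine ⟨.cons hac p, ?_, ?_⟩
  · simp only [SimpleGraph.Walk.support_cons, List.mem_cons, forall_eq_or_imp]
    exact ⟨T.refl a, fun x hx => T.trans hac' (hp x hx)⟩
  · rw [walkLength, T.len_of_le hac hac']
    refine (add_le_add le_rfl hl).trans_eq ?_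
    rw [← ENNReal.ofReal_add (sub_nonneg.2 (T.height_le_of_le hac'))
      (sub_nonneg.2 (T.height_le_of_le hcb)), sub_add_sub_cancel]
termination_by T.level b - T.level a

theorem linked_up {t a b : V} (ha : a ∈ T.up t) (hb : b ∈ T.up t) : Linked G (T.up t) a b := by
  obtain ⟨p, hp, -⟩ := T.exists_walk ha
  obtain ⟨q, hq, -⟩ := T.exists_walk hb
  exact Linked.trans (Linked.symm ⟨p, hp⟩) ⟨q, hq⟩

theorem connected (T : NormalSpanningTree G) : G.Connected :=
  (SimpleGraph.connected_iff_exists_forall_reachable G).2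
    ⟨T.root, fun v => ⟨(T.exists_walk (T.root_le v)).choose⟩⟩

/-! ### The metric -/

noncomputable instance : MetricSpace (LTop T.len) := LTop.metricSpace T.len T.connected

theorem dist_ofPoint_le {x y : Point G} {c : ℝ} (hc : 0 ≤ c)
    (h : arcDist T.len x y ≤ ENNReal.ofReal c) :
    dist (LTop.ofPoint T.len x) (LTop.ofPoint T.len y) ≤ c :=
  (LTop.dist_ofPoint T.len T.connected x y).trans_le (ENNReal.toReal_le_of_le_ofReal hc h)

theorem abs_sub_le_mul_dist {φ : Point G → ℝ} {K : NNReal}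
    (hφ : LipschitzWith K fun x : LengthSpace T.len => φ x) (x y : Point G) :
    |φ x - φ y| ≤ K * dist (LTop.ofPoint T.len x) (LTop.ofPoint T.len y) := by
  rw [LTop.dist_ofPoint T.len T.connected, ← Real.dist_eq, dist_edist, ← ENNReal.coe_toReal,
    ← ENNReal.toReal_mul]
  exact ENNReal.toReal_mono (ENNReal.mul_ne_top ENNReal.coe_ne_top
    (arcDist_ne_top T.len T.connected x y)) (hφ x y)

theorem dist_ofPoint_vertex_le_height {t a : V} (ha : a ∈ T.up t) :
    dist (LTop.ofPoint T.len (.vertex G a)) (LTop.ofPoint T.len (.vertex G t)) ≤ T.height t := by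
  obtain ⟨p, -, hp⟩ := T.exists_walk ha
  rw [dist_comm]
  refine T.dist_ofPoint_le (T.height_pos t).le ((arcDist_vertex_le_walkLength _ p).trans
    (hp.trans (ENNReal.ofReal_le_ofReal ?_)))
  linarith [T.height_pos a]

theorem dist_ofPoint_vertex_le_one_sub_coord {x : Point G} {v : V} (h : 0 < x.coord v) :
    dist (LTop.ofPoint T.len x) (LTop.ofPoint T.len (.vertex G v)) ≤ 1 - x.coord v :=
  T.dist_ofPoint_le (sub_nonneg.2 (x.coord_le_one v))
    (arcDist_vertex_le_one_sub_coord T.len_le_one h)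

theorem dist_ofPoint_le_abs_sub_coord {x y : Point G} {a b : V} (hx : x.OnEdge a b)
    (hy : y.OnEdge a b) :
    dist (LTop.ofPoint T.len x) (LTop.ofPoint T.len y) ≤ |x.coord a - y.coord a| :=
  T.dist_ofPoint_le (abs_nonneg _)
    ((arcDist_le_of_onEdge hx hy (T.len_le_one _)).trans_eq (by rw [mul_one]))

theorem dist_ofPoint_le_height {x y : Point G} {a b t : V} (hx : x.OnEdge a b) (hy : y.OnEdge a b)
    (ha : a ∈ T.up t) (hb : b ∈ T.up t) :
    dist (LTop.ofPoint T.len x) (LTop.ofPoint T.len y) ≤ T.height t := by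
  refine T.dist_ofPoint_le (T.height_pos t).le ((arcDist_le_of_onEdge hx hy
    (T.len_le_height hx.1 ha hb)).trans (ENNReal.ofReal_le_ofReal ?_))
  refine mul_le_of_le_one_left (T.height_pos t).le (abs_le.2 ⟨?_, ?_⟩) <;>
    linarith [x.coord_nonneg a, x.coord_le_one a, y.coord_nonneg a, y.coord_le_one a]

theorem dist_ofPoint_vertex_le_of_mass_pos {t : V} {x : Point G} (h : 0 < Point.mass (T.up t) x) :
    dist (LTop.ofPoint T.len x) (LTop.ofPoint T.len (.vertex G t)) ≤
      1 - Point.mass (T.up t) x + 2 * T.height t := by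
  have hm := Point.mass_le_one (T.up t) x
  have ht := T.height_pos t
  obtain ⟨a, ha, hxa⟩ := Point.exists_coord_pos_of_mass_pos h
  suffices hs : dist (LTop.ofPoint T.len x) (LTop.ofPoint T.len (.vertex G a)) ≤
      1 - Point.mass (T.up t) x + T.height t by
    linarith [dist_triangle (LTop.ofPoint T.len x) (LTop.ofPoint T.len (.vertex G a))
      (LTop.ofPoint T.len (.vertex G t)), T.dist_ofPoint_vertex_le_height ha]
  rcases Point.eq_vertex_or_exists_innerOf_of_pos hxa with rfl | ⟨b, hb⟩
  · rw [dist_self]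
    linarith
  by_cases hbt : b ∈ T.up t
  · linarith [T.dist_ofPoint_le_height hb.1 (Point.vertex_onEdge hb.1.1) ha hbt]
  · rw [Point.mass_of_onEdge _ hb.1, Set.indicator_of_mem ha, Set.indicator_of_notMem hbt]
    linarith [T.dist_ofPoint_vertex_le_one_sub_coord hxa]

theorem lipschitzWith_mass_up (t : V) : LipschitzWith (Real.toNNReal (T.height t)⁻¹)
    fun x : LengthSpace T.len => Point.mass (T.up t) x := by
  have ht := inv_pos.2 (T.height_pos t)
  refine lipschitzWith_mass (Real.toNNReal_pos.2 ht).ne' (fun e => (T.len_pos e).le)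
    fun a b hab ha hb => ?_
  rw [Real.coe_toNNReal _ ht.le, ← div_eq_inv_mul, one_le_div (T.height_pos t)]
  exact T.height_le_len hab ha hb

theorem lipschitzWith_coord (v : V) : LipschitzWith (Real.toNNReal (T.height v / 2)⁻¹)
    fun x : LengthSpace T.len => Point.coord x v := by
  have hv := half_pos (T.height_pos v)
  have hv' := inv_pos.2 hv
  rw [show (fun x : LengthSpace T.len => Point.coord x v) = fun x => Point.mass {v} x from
    funext fun x => (Point.mass_singleton v x).symm]
  refine lipschitzWith_mass (Real.toNNReal_pos.2 hv').ne' (fun e => (T.len_pos e).le)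
    fun a b hab ha _ => ?_
  rw [Real.coe_toNNReal _ hv'.le, ← div_eq_inv_mul, one_le_div hv]
  obtain rfl := Set.mem_singleton_iff.1 ha
  exact T.half_height_le_len hab

/-! ### Ends and branches -/

theorem finite_setOf_le_ne (t : V) : {a | T.le a t ∧ a ≠ t}.Finite := by
  refine Set.Finite.of_finite_image ((Set.finite_Iio (T.level t)).subset ?_) (f := T.level) ?_
  · rintro _ ⟨a, ha, rfl⟩
    exact T.level_lt ha.1 ha.2
  · exact fun a ha b hb h => T.eq_of_level_eq ha.1 hb.1 h

/-- The vertices strictly below `t` in the tree order; they separate `T.up t` from the rest of the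
graph. -/
noncomputable def below (t : V) : Finset V := (T.finite_setOf_le_ne t).toFinset

theorem mem_below {a t : V} : a ∈ T.below t ↔ T.le a t ∧ a ≠ t := by simp [below]

theorem up_subset_compl_below (t : V) : T.up t ⊆ (T.below t : Set V)ᶜ := fun _ ha h =>
  (T.mem_below.1 h).2 (T.eq_of_le_of_level_le (T.mem_below.1 h).1 (T.level_le ha))

theorem mem_up_of_linked {t a b : V} (ha : a ∈ T.up t)
    (h : Linked G (T.below t : Set V)ᶜ a b) : b ∈ T.up t := by
  obtain ⟨p, hp⟩ := h
  induction p with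
  | nil => exact ha
  | cons h p ih =>
    simp only [SimpleGraph.Walk.support_cons, List.mem_cons, forall_eq_or_imp] at hp
    refine ih (by_contra fun hb => ?_) hp.2
    exact hp.2 _ p.start_mem_support (T.mem_below.2 (T.le_of_adj_of_notMem_up h ha hb))

theorem endComponent_below_of_mem {ω : VertexEnd G} {t v : V}
    (hv : v ∈ endComponent (T.below t) ω) (hvt : v ∈ T.up t) :
    endComponent (T.below t) ω = T.up t := by
  obtain ⟨C, hC, -⟩ := exists_endComponent_eq (T.below t) ω
  refine Set.Subset.antisymm (fun w hw => ?_) fun w hw =>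
    mem_endComponent_of_linked hv ((T.linked_up hvt hw).mono (T.up_subset_compl_below t))
  rw [hC] at hv hw
  exact T.mem_up_of_linked hvt (Linked.of_mem_component hv hw)

theorem endComponent_below_mk {R : Ray G} {t : V} (h : R.HasTailIn (T.up t)) :
    endComponent (T.below t) (Quotient.mk _ R) = T.up t := by
  obtain ⟨N, hN⟩ := hasTailIn_endComponent (T.below t) R
  obtain ⟨M, hM⟩ := h
  exact T.endComponent_below_of_mem (hN _ (le_max_right M N)) (hM _ (le_max_left M N))

theorem hasTailIn_up_of_mk_eq {R L : Ray G} (hRL : Quotient.mk (raySetoid G) R = Quotient.mk _ L)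
    {t : V} (h : R.HasTailIn (T.up t)) : L.HasTailIn (T.up t) := by
  rw [← T.endComponent_below_mk h, hRL]
  exact hasTailIn_endComponent _ L

theorem exists_hasTailIn_up (R : Ray G) (n : ℕ) : ∃ t, T.level t = n ∧ R.HasTailIn (T.up t) := by
  induction n with
  | zero => exact ⟨T.root, T.level_root, 0, fun n _ => T.root_le _⟩
  | succ n ih =>
    obtain ⟨t, rfl, N, hN⟩ := ih
    have hfin : {m | R.vert m = t}.Finite :=
      (Set.finite_singleton t).preimage R.injective.injOn
    obtain ⟨B, hB⟩ := hfin.bddAbove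
    have hne (m : ℕ) (hm : B < m) : t ≠ R.vert m := fun h => (hB h.symm).not_gt hm
    set M := max N (B + 1)
    obtain ⟨c, -, hc, -, hcM⟩ := T.exists_child (hN M (le_max_left _ _))
      (hne M (Nat.lt_of_succ_le (le_max_right _ _)))
    refine ⟨c, hc, M, fun m hm => ?_⟩
    induction m, hm using Nat.le_induction with
    | base => exact hcM
    | succ m hm ih =>
      rcases T.le_or_le_of_adj (R.adj m) with h | h
      · exact T.trans ih h
      · have hm' := max_le_iff.1 (hm.trans m.le_succ)
        exact T.le_of_level_le ih h (hc.trans_le (T.level_lt (hN _ hm'.1) (hne _ hm'.2)))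

/-- The vertex of level `n` above which the rays of `ω` have tails. -/
noncomputable def branch (ω : VertexEnd G) (n : ℕ) : V :=
  (T.exists_hasTailIn_up (Quotient.out ω) n).choose

theorem level_branch (ω : VertexEnd G) (n : ℕ) : T.level (T.branch ω n) = n :=
  (T.exists_hasTailIn_up (Quotient.out ω) n).choose_spec.1

theorem hasTailIn_up_branch (R : Ray G) (n : ℕ) :
    R.HasTailIn (T.up (T.branch (Quotient.mk _ R) n)) :=
  T.hasTailIn_up_of_mk_eq (Quotient.out_eq _)
    (T.exists_hasTailIn_up (Quotient.out (Quotient.mk (raySetoid G) R)) n).choose_spec.2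

theorem le_of_hasTailIn {R : Ray G} {s t : V} (hs : R.HasTailIn (T.up s))
    (ht : R.HasTailIn (T.up t)) (h : T.level s ≤ T.level t) : T.le s t := by
  obtain ⟨N, hN⟩ := hs
  obtain ⟨M, hM⟩ := ht
  exact T.le_of_level_le (hN (max N M) (le_max_left _ _)) (hM (max N M) (le_max_right _ _)) h

theorem branch_mk_eq_iff {R : Ray G} {t : V} :
    T.branch (Quotient.mk _ R) (T.level t) = t ↔ R.HasTailIn (T.up t) := by
  have h := T.hasTailIn_up_branch R (T.level t)
  refine ⟨fun e => e ▸ h, fun ht => ?_⟩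
  exact T.eq_of_le_of_level_le (T.le_of_hasTailIn h ht (T.level_branch _ _).le)
    (T.level_branch _ _).ge

theorem branch_le (ω : VertexEnd G) {m n : ℕ} (h : m ≤ n) :
    T.le (T.branch ω m) (T.branch ω n) := by
  induction ω using Quotient.inductionOn with
  | _ R =>
    exact T.le_of_hasTailIn (T.hasTailIn_up_branch R m) (T.hasTailIn_up_branch R n)
      ((T.level_branch _ _).le.trans (h.trans (T.level_branch _ _).ge))

/-- An infinite branch of the tree, as a ray. -/
def rayOfBranch (t : ℕ → V) (hl : ∀ n, T.level (t n) = n) (hle : ∀ n, T.le (t n) (t (n + 1))) :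
    Ray G where
  vert := t
  injective m n h := by rw [← hl m, ← hl n, h]
  adj n := T.adj_of_level_eq_succ (hle n) (by rw [hl, hl])

theorem branch_rayOfBranch (t : ℕ → V) (hl : ∀ n, T.level (t n) = n)
    (hle : ∀ n, T.le (t n) (t (n + 1))) (n : ℕ) :
    T.branch (Quotient.mk _ (T.rayOfBranch t hl hle)) n = t n := by
  have : (T.rayOfBranch t hl hle).HasTailIn (T.up (t n)) := by
    refine ⟨n, fun m hm => ?_⟩
    induction m, hm using Nat.le_induction with
    | base => exact T.refl _
    | succ m _ ih => exact T.trans ih (hle m)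
  rwa [← T.branch_mk_eq_iff, hl] at this

theorem exists_up_branch_subset_compl (S : Finset V) (ω : VertexEnd G) :
    ∃ n, T.up (T.branch ω n) ⊆ (S : Set V)ᶜ := by
  refine ⟨S.sup T.level + 1, fun v hv hS => ?_⟩
  have hlevel := T.level_le hv
  have hsup : T.level v ≤ S.sup T.level := Finset.le_sup hS
  rw [T.level_branch] at hlevel
  omega

theorem exists_up_branch_subset_endComponent (S : Finset V) (ω : VertexEnd G) :
    ∃ n, T.up (T.branch ω n) ⊆ endComponent S ω := by
  obtain ⟨n, hn⟩ := T.exists_up_branch_subset_compl S ω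
  refine ⟨n, fun v hv => ?_⟩
  induction ω using Quotient.inductionOn with
  | _ R =>
    obtain ⟨N, hN⟩ := T.hasTailIn_up_branch R n
    obtain ⟨M, hM⟩ := hasTailIn_endComponent S R
    exact mem_endComponent_of_linked (hM _ (le_max_right N M))
      ((T.linked_up (hN _ (le_max_left N M)) hv).mono hn)

theorem branch_injective : Function.Injective T.branch := by
  intro ω ω' h
  induction ω using Quotient.inductionOn with
  | _ R =>
    induction ω' using Quotient.inductionOn with
    | _ L =>
      refine Quotient.sound fun S => ?_
      obtain ⟨C, hC, -⟩ := exists_endComponent_eq S (Quotient.mk _ R)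
      obtain ⟨n, hn⟩ := T.exists_up_branch_subset_endComponent S (Quotient.mk _ R)
      rw [hC] at hn
      refine ⟨C, (T.hasTailIn_up_branch R n).mono hn, ?_⟩
      rw [h] at hn
      exact (T.hasTailIn_up_branch L n).mono hn

theorem endComponent_below_branch (ω : VertexEnd G) (n : ℕ) :
    endComponent (T.below (T.branch ω n)) ω = T.up (T.branch ω n) := by
  induction ω using Quotient.inductionOn with
  | _ R => exact T.endComponent_below_mk (T.hasTailIn_up_branch R n)

theorem hasRayIn_up_iff {ω : VertexEnd G} {t : V} :
    ω.HasRayIn (T.up t) ↔ T.branch ω (T.level t) = t := by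
  refine ⟨?_, fun h => ?_⟩
  · rintro ⟨R, rfl, hR⟩
    exact T.branch_mk_eq_iff.2 ⟨0, fun n _ => hR n⟩
  · induction ω using Quotient.inductionOn with
    | _ R => exact (T.branch_mk_eq_iff.1 h).hasRayIn

end NormalSpanningTree

/-! ### The topology of `MTOP(G)` in terms of coordinates and masses -/

namespace MTop

/-- The barycentric coordinate at `v`, extended by `0` to the vertex-ends. -/
noncomputable def coord (v : V) : MTop G → ℝ
  | point x => x.coord v
  | vertexEnd _ => 0

open Classical in
/-- The total weight that a point of `MTOP(G)` gives to `A`; a vertex-end has weight `1` if it has a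
ray in `A`, and `0` otherwise. -/
noncomputable def mass (A : Set V) : MTop G → ℝ
  | point x => Point.mass A x
  | vertexEnd ω => if ω.HasRayIn A then 1 else 0

theorem mass_vertexEnd_of_hasRayIn {A : Set V} {ω : VertexEnd G} (h : ω.HasRayIn A) :
    mass A (vertexEnd ω) = 1 := if_pos h

theorem hasRayIn_of_mass_pos {A : Set V} {ω : VertexEnd G} (h : 0 < mass A (vertexEnd ω)) :
    ω.HasRayIn A := by
  by_contra hA
  exact h.ne' (if_neg hA)

theorem point_mem_endNhd_iff_exists {S : Finset V} {ω : VertexEnd G} {ε : ℝ} {x : Point G} :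
    point x ∈ endNhd S ω ε ↔ ∃ c ∈ endComponent S ω, 0 < x.coord c ∧
      ∀ s ∈ S, 0 < x.coord s → 1 - ε < x.coord c := by
  rw [point_mem_endNhd]
  constructor
  · rintro (h | ⟨s, -, c, hc, hx, hε⟩)
    · obtain ⟨c, -, hc⟩ := Point.exists_coord_pos_of_mass_pos
        ((Point.mass_univ x).symm ▸ one_pos)
      exact ⟨c, h c hc.ne', hc, fun s hs hxs =>
        absurd hs (notMem_of_mem_endComponent (h s hxs.ne'))⟩
    · exact ⟨c, hc, hx.2.2, fun _ _ _ => by linarith⟩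
  · rintro ⟨c, hc, hxc, h⟩
    refine or_iff_not_imp_left.2 fun hall => ?_
    push Not at hall
    obtain ⟨v, hv, hvC⟩ := hall
    have hv0 : 0 < x.coord v := (x.coord_nonneg v).lt_of_ne' hv
    have hin : x.InnerOf v c := Point.innerOf_of_pos (fun e => hvC (e ▸ hc)) hv0 hxc
    have hvS : v ∈ S := by
      by_contra hvS
      exact hvC (mem_endComponent_of_linked hc
        (Linked.of_adj (notMem_of_mem_endComponent hc) hvS hin.1.1.symm))
    exact ⟨v, hvS, c, hc, hin, by linarith [h v hvS hv0]⟩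

theorem edgePart_eq {a b : V} (hab : a ≠ b) (U : Set ℝ) :
    edgePart G a b U = coord a ⁻¹' U ∩ {p | 0 < coord a p} ∩ {p | 0 < coord b p} := by
  ext (x | ω)
  · refine point_mem_edgePart.trans ⟨fun h => ⟨⟨h.2, h.1.2.1⟩, h.1.2.2⟩, fun h => ?_⟩
    exact ⟨Point.innerOf_of_pos hab h.1.2 h.2, h.1.1⟩
  · exact iff_of_false vertexEnd_notMem_edgePart fun h => lt_irrefl (0 : ℝ) h.2

theorem edgePart_self (a : V) (U : Set ℝ) : edgePart G a a U = ∅ :=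
  Set.eq_empty_of_forall_notMem fun _ ⟨_, _, hx, _⟩ => G.irrefl hx.1.1

theorem openStar_eq (v : V) {ε : ℝ} (hε : ε ≤ 1) :
    openStar G v ε = {p | 1 - ε < coord v p} := by
  ext (x | ω)
  · exact point_mem_openStar.trans sub_lt_comm
  · exact iff_of_false vertexEnd_notMem_openStar (sub_nonneg.2 hε).not_gt

theorem setOf_lt_coord_subset_endNhd {S : Finset V} {ω : VertexEnd G} {c : V}
    (hc : c ∈ endComponent S ω) (ε : ℝ) :
    {p | max 0 (1 - ε) < coord c p} ⊆ endNhd S ω ε := by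
  intro p hp
  obtain ⟨hpos, hε⟩ := max_lt_iff.1 (Set.mem_ofPred_eq ▸ hp)
  rcases p with x | ω'
  · exact point_mem_endNhd_iff_exists.2 ⟨c, hc, hpos, fun _ _ _ => hε⟩
  · exact absurd hpos (lt_irrefl _)

theorem setOf_coord_pos_subset_endNhd {S : Finset V} {ω : VertexEnd G} {b c : V}
    (hc : c ∈ endComponent S ω) (hb : b ∉ S) (hcb : c ≠ b) (ε : ℝ) :
    {p | 0 < coord c p} ∩ {p | 0 < coord b p} ⊆ endNhd S ω ε := by
  rintro (x | ω') ⟨hxc, hxb⟩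
  · refine point_mem_endNhd_iff_exists.2 ⟨c, hc, hxc, fun s hs hxs => ?_⟩
    rcases (Point.innerOf_of_pos hcb hxc hxb).1.eq_or_eq_of_coord_ne_zero hxs.ne' with rfl | rfl
    · exact absurd hs (notMem_of_mem_endComponent hc)
    · exact absurd hs hb
  · exact absurd hxc (lt_irrefl (0 : ℝ))

theorem setOf_lt_mass_subset_endNhd {S : Finset V} {ω : VertexEnd G} {A : Set V}
    (hA : A ⊆ endComponent S ω) (ε : ℝ) :
    {p | max 0 (1 - ε) < mass A p} ⊆ endNhd S ω ε := by
  intro p hp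
  obtain ⟨hpos, hε⟩ := max_lt_iff.1 (Set.mem_ofPred_eq ▸ hp)
  rcases p with x | ω'
  · obtain ⟨c, hc, hxc⟩ := Point.exists_coord_pos_of_mass_pos hpos
    refine point_mem_endNhd_iff_exists.2 ⟨c, hA hc, hxc, fun s hs hxs => ?_⟩
    have hsA : s ∉ A := fun h => notMem_of_mem_endComponent (hA h) hs
    have hx := Point.innerOf_of_pos (ne_of_mem_of_not_mem hc hsA) hxc hxs
    have hmass := Point.mass_of_onEdge A hx.1
    rw [Set.indicator_of_mem hc, Set.indicator_of_notMem hsA, add_zero] at hmass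
    exact hε.trans_eq hmass
  · exact vertexEnd_mem_endNhd.2 ((hasRayIn_of_mass_pos hpos).mono hA)

theorem endNhd_subset {S : Finset V} {ω : VertexEnd G} {ε : ℝ} (hε : 0 < ε) :
    endNhd S ω ε ⊆ {p | 1 - ε < mass (endComponent S ω) p} := by
  rintro (x | ω') h
  · rcases point_mem_endNhd.1 h with h | ⟨s, -, c, hc, -, hxc⟩
    · exact (sub_lt_self 1 hε).trans_eq (Point.mass_eq_one h).symm
    · exact (sub_lt_comm.1 hxc).trans_le (Point.coord_le_mass hc x)
  · exact (sub_lt_self 1 hε).trans_eq (mass_vertexEnd_of_hasRayIn (vertexEnd_mem_endNhd.1 h)).symm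

end MTop

namespace NormalSpanningTree

variable (T : NormalSpanningTree G)

theorem endNhd_eq (S : Finset V) (ω : VertexEnd G) {ε : ℝ} (hε : 0 < ε) :
    MTop.endNhd S ω ε = (⋃ c ∈ endComponent S ω, {p | max 0 (1 - ε) < MTop.coord c p}) ∪
      (⋃ c ∈ endComponent S ω, ⋃ b ∈ {b | b ∉ S ∧ c ≠ b},
        {p | 0 < MTop.coord c p} ∩ {p | 0 < MTop.coord b p}) ∪
      ⋃ t ∈ {t | T.up t ⊆ endComponent S ω}, {p | max 0 (1 - ε) < MTop.mass (T.up t) p} := by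
  refine Set.Subset.antisymm ?_ (Set.union_subset (Set.union_subset ?_ ?_) ?_)
  · rintro (x | ω') h
    · refine .inl ?_
      obtain ⟨c, hc, hxc, hS⟩ := MTop.point_mem_endNhd_iff_exists.1 h
      by_cases hεc : 1 - ε < x.coord c
      · exact .inl (Set.mem_biUnion hc (max_lt hxc hεc))
      obtain rfl | ⟨b, hb⟩ := Point.eq_vertex_or_exists_innerOf_of_pos hxc
      · rw [Point.vertex_coord_self] at hεc
        exact absurd (sub_lt_self 1 hε) hεc
      · exact .inr (Set.mem_biUnion hc (Set.mem_biUnion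
          ⟨fun hbS => hεc (hS b hbS hb.2.2), hb.1.1.ne⟩ hb.2))
    · have hω := endComponent_eq_of_hasRayIn (MTop.vertexEnd_mem_endNhd.1 h)
      obtain ⟨n, hn⟩ := T.exists_up_branch_subset_endComponent S ω'
      refine .inr (Set.mem_biUnion (hω ▸ hn) ?_)
      rw [Set.mem_ofPred_eq, MTop.mass_vertexEnd_of_hasRayIn
        (T.hasRayIn_up_iff.2 (by rw [T.level_branch]))]
      exact max_lt one_pos (sub_lt_self 1 hε)
  · exact Set.iUnion₂_subset fun c hc => MTop.setOf_lt_coord_subset_endNhd hc ε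
  · exact Set.iUnion₂_subset fun c hc => Set.iUnion₂_subset fun b hb =>
      MTop.setOf_coord_pos_subset_endNhd hc hb.1 hb.2 ε
  · exact Set.iUnion₂_subset fun t ht => MTop.setOf_lt_mass_subset_endNhd ht ε

/-! ### The embedding of `MTOP(G)` into the completion -/

/-- The continuous extension to `|G|_ℓ` of the barycentric coordinate at `v`. -/
noncomputable def coordExt (v : V) : LTop T.len → ℝ :=
  LTop.extend T.len fun x => x.coord v

theorem continuous_coordExt (v : V) : Continuous (T.coordExt v) := LTop.continuous_extend _

theorem coordExt_ofPoint (v : V) (x : Point G) :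
    T.coordExt v (LTop.ofPoint T.len x) = x.coord v :=
  LTop.extend_ofPoint (T.lipschitzWith_coord v).uniformContinuous x

/-- The continuous extension to `|G|_ℓ` of the mass above `t`. -/
noncomputable def massExt (t : V) : LTop T.len → ℝ :=
  LTop.extend T.len (Point.mass (T.up t))

theorem continuous_massExt (t : V) : Continuous (T.massExt t) := LTop.continuous_extend _

theorem massExt_ofPoint (t : V) (x : Point G) :
    T.massExt t (LTop.ofPoint T.len x) = Point.mass (T.up t) x :=
  LTop.extend_ofPoint (T.lipschitzWith_mass_up t).uniformContinuous x

open Filter Topology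

theorem exists_tendsto_branch (ω : VertexEnd G) : ∃ z : LTop T.len,
    Tendsto (fun n => LTop.ofPoint T.len (.vertex G (T.branch ω n))) atTop (𝓝 z) := by
  refine cauchySeq_tendsto_of_complete
    (cauchySeq_of_le_geometric (1 / 2) 1 (by norm_num) fun n => ?_)
  rw [dist_comm, one_mul]
  refine (T.dist_ofPoint_vertex_le_height (T.branch_le ω n.le_succ)).trans_eq ?_
  rw [height, T.level_branch]

/-- The point of `|G|_ℓ` to which the branch of `ω` converges. -/
noncomputable def endPoint (ω : VertexEnd G) : LTop T.len := (T.exists_tendsto_branch ω).choose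

theorem tendsto_endPoint (ω : VertexEnd G) :
    Tendsto (fun n => LTop.ofPoint T.len (.vertex G (T.branch ω n))) atTop (𝓝 (T.endPoint ω)) :=
  (T.exists_tendsto_branch ω).choose_spec

/-- The map `MTOP(G) → |G|_ℓ` that is the identity on `G` and maps a vertex-end to the limit of its
branch. -/
noncomputable def toLTop : MTop G → LTop T.len
  | .point x => LTop.ofPoint T.len x
  | .vertexEnd ω => T.endPoint ω

theorem coordExt_toLTop (v : V) (p : MTop G) : T.coordExt v (T.toLTop p) = MTop.coord v p := by
  rcases p with x | ω
  · exact T.coordExt_ofPoint v x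
  refine tendsto_nhds_unique (((T.continuous_coordExt v).tendsto _).comp (T.tendsto_endPoint ω))
    (tendsto_const_nhds.congr' ?_)
  filter_upwards [eventually_gt_atTop (T.level v)] with n hn
  rw [Function.comp_apply, coordExt_ofPoint, Point.vertex_coord_ne]
  · rfl
  · rintro rfl
    exact hn.ne (T.level_branch ω n)

theorem branch_mem_up_iff {ω : VertexEnd G} {t : V} {n : ℕ} (hn : T.level t ≤ n) :
    T.branch ω n ∈ T.up t ↔ ω.HasRayIn (T.up t) := by
  rw [T.hasRayIn_up_iff]
  have hle := T.branch_le ω hn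
  exact ⟨fun h => T.eq_of_level_eq hle h (T.level_branch _ _), fun h => h ▸ hle⟩

theorem massExt_toLTop (t : V) (p : MTop G) :
    T.massExt t (T.toLTop p) = MTop.mass (T.up t) p := by
  rcases p with x | ω
  · exact T.massExt_ofPoint t x
  refine tendsto_nhds_unique (((T.continuous_massExt t).tendsto _).comp (T.tendsto_endPoint ω))
    (tendsto_const_nhds.congr' ?_)
  filter_upwards [eventually_ge_atTop (T.level t)] with n hn
  rw [Function.comp_apply, massExt_ofPoint, Point.mass_vertex]
  classical
  simp only [MTop.mass, Set.indicator_apply, T.branch_mem_up_iff hn, Pi.one_apply]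

theorem toLTop_injective : Function.Injective T.toLTop := by
  intro p q h
  have hcoord (v : V) : MTop.coord v p = MTop.coord v q := by
    rw [← T.coordExt_toLTop, h, T.coordExt_toLTop]
  have hmass (t : V) : MTop.mass (T.up t) p = MTop.mass (T.up t) q := by
    rw [← T.massExt_toLTop, h, T.massExt_toLTop]
  have hne (x : Point G) : ∃ v, MTop.coord v (.point x) ≠ 0 := by
    obtain ⟨v, -, hv⟩ := Point.exists_coord_pos_of_mass_pos ((Point.mass_univ x).symm ▸ one_pos)
    exact ⟨v, hv.ne'⟩
  rcases p with x | ω <;> rcases q with y | ω'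
  · exact congrArg _ (Point.ext_coord hcoord)
  · obtain ⟨v, hv⟩ := hne x
    exact absurd (hcoord v) hv
  · obtain ⟨v, hv⟩ := hne y
    exact absurd (hcoord v).symm hv
  · refine congrArg _ (T.branch_injective (funext fun n => ?_))
    have hω : ω.HasRayIn (T.up (T.branch ω n)) := T.hasRayIn_up_iff.2 (by rw [T.level_branch])
    have hω' := MTop.hasRayIn_of_mass_pos
      (((MTop.mass_vertexEnd_of_hasRayIn hω).symm.trans (hmass _)) ▸ one_pos)
    rw [T.hasRayIn_up_iff, T.level_branch] at hω'
    exact hω'.symm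

theorem dist_endPoint_vertex_le {ω : VertexEnd G} {t : V} (h : ω.HasRayIn (T.up t)) :
    dist (T.endPoint ω) (LTop.ofPoint T.len (.vertex G t)) ≤ T.height t := by
  refine le_of_tendsto ((T.tendsto_endPoint ω).dist tendsto_const_nhds) ?_
  filter_upwards [eventually_ge_atTop (T.level t)] with n hn
  exact T.dist_ofPoint_vertex_le_height ((T.branch_mem_up_iff hn).2 h)

theorem dist_toLTop_vertex_le {t : V} {p : MTop G} (h : 0 < MTop.mass (T.up t) p) :
    dist (T.toLTop p) (LTop.ofPoint T.len (.vertex G t)) ≤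
      1 - MTop.mass (T.up t) p + 2 * T.height t := by
  rcases p with x | ω
  · exact T.dist_ofPoint_vertex_le_of_mass_pos h
  · have hω := MTop.hasRayIn_of_mass_pos h
    have hdist : dist (T.toLTop (.vertexEnd ω)) _ ≤ _ := T.dist_endPoint_vertex_le hω
    rw [MTop.mass_vertexEnd_of_hasRayIn hω]
    linarith [T.height_pos t]

theorem continuousAt_toLTop_vertex (v : V) : ContinuousAt T.toLTop (.point (.vertex G v)) := by
  refine Metric.tendsto_nhds.2 fun ε hε => ?_
  have hδ : 0 < min ε (1 / 2) := by positivity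
  filter_upwards [(MTop.isOpen_openStar v hδ ((min_le_right _ _).trans_lt (by norm_num))).mem_nhds
    (MTop.point_mem_openStar.2 (by rwa [Point.vertex_coord_self, sub_self]))]
  rintro _ ⟨y, rfl, hy⟩
  obtain ⟨hyε, hy'⟩ := lt_min_iff.1 hy
  exact (T.dist_ofPoint_vertex_le_one_sub_coord (by linarith)).trans_lt hyε

theorem continuousAt_toLTop_of_innerOf {x : Point G} {a b : V} (hx : x.InnerOf a b) :
    ContinuousAt T.toLTop (.point x) := by
  refine Metric.tendsto_nhds.2 fun ε hε => ?_
  filter_upwards [(MTop.isOpen_edgePart a b Metric.isOpen_ball).mem_nhds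
    (MTop.point_mem_edgePart.2 ⟨hx, Metric.mem_ball_self hε⟩)]
  rintro _ ⟨y, rfl, hy, hyx⟩
  exact (T.dist_ofPoint_le_abs_sub_coord hy.1 hx.1).trans_lt hyx

theorem continuousAt_toLTop_vertexEnd (ω : VertexEnd G) :
    ContinuousAt T.toLTop (.vertexEnd ω) := by
  refine Metric.tendsto_nhds.2 fun ε hε => ?_
  obtain ⟨n, hn⟩ := exists_pow_lt_of_lt_one (show 0 < ε / 6 by positivity)
    (show (1 / 2 : ℝ) < 1 by norm_num)
  have hC := T.endComponent_below_branch ω n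
  have hω : ω.HasRayIn (T.up (T.branch ω n)) := T.hasRayIn_up_iff.2 (by rw [T.level_branch])
  rw [← T.level_branch ω n, ← height] at hn
  generalize T.branch ω n = t at *
  have hδ : 0 < min (ε / 2) 1 := by positivity
  filter_upwards [(MTop.isOpen_endNhd (T.below t) ω hδ).mem_nhds
    (MTop.vertexEnd_mem_endNhd.2 (hC ▸ hω))] with q hq
  have hmass := MTop.endNhd_subset hδ hq
  rw [hC, Set.mem_ofPred_eq] at hmass
  have hdist := T.dist_toLTop_vertex_le
    ((sub_nonneg.2 (min_le_right (ε / 2) 1)).trans_lt hmass)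
  have hdistω : dist (T.toLTop (.vertexEnd ω)) _ ≤ _ := T.dist_endPoint_vertex_le hω
  linarith [dist_triangle_right (T.toLTop q) (T.toLTop (.vertexEnd ω))
    (LTop.ofPoint T.len (.vertex G t)), min_le_left (ε / 2) 1]

theorem continuous_toLTop : Continuous T.toLTop := by
  rw [continuous_iff_continuousAt]
  rintro (x | ω)
  · rcases x.eq_vertex_or_innerOf with ⟨v, rfl⟩ | ⟨a, b, hab⟩
    · exact T.continuousAt_toLTop_vertex v
    · exact T.continuousAt_toLTop_of_innerOf hab
  · exact T.continuousAt_toLTop_vertexEnd ω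

theorem isInducing_toLTop : IsInducing T.toLTop := by
  refine ⟨le_antisymm T.continuous_toLTop.le_induced (le_generateFrom fun A hA => ?_)⟩
  let _ := TopologicalSpace.induced T.toLTop inferInstance
  have hcoord (v : V) : Continuous (MTop.coord (G := G) v) := by
    rw [← funext (T.coordExt_toLTop v)]
    exact (T.continuous_coordExt v).comp continuous_induced_dom
  have hmass (t : V) : Continuous (MTop.mass (G := G) (T.up t)) := by
    rw [← funext (T.massExt_toLTop t)]
    exact (T.continuous_massExt t).comp continuous_induced_dom
  change IsOpen A
  rcases hA with (⟨a, b, U, hU, rfl⟩ | ⟨v, ε, -, h1, rfl⟩) | ⟨S, ω, ε, h0, rfl⟩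
  · rcases eq_or_ne a b with rfl | hab
    · rw [MTop.edgePart_self]
      exact isOpen_empty
    · rw [MTop.edgePart_eq hab]
      exact ((hU.preimage (hcoord a)).inter (isOpen_lt continuous_const (hcoord a))).inter
        (isOpen_lt continuous_const (hcoord b))
  · rw [MTop.openStar_eq v h1.le]
    exact isOpen_lt continuous_const (hcoord v)
  · rw [T.endNhd_eq S ω h0]
    refine ((isOpen_biUnion fun c _ => ?_).union (isOpen_biUnion fun c _ => isOpen_biUnion
      fun b _ => ?_)).union (isOpen_biUnion fun t _ => ?_)
    · exact isOpen_lt continuous_const (hcoord c)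
    · exact (isOpen_lt continuous_const (hcoord c)).inter (isOpen_lt continuous_const (hcoord b))
    · exact isOpen_lt continuous_const (hmass t)

/-! ### Surjectivity -/

theorem dist_vertex_le_one_sub_coordExt {z : LTop T.len} {v : V} (h : 0 < T.coordExt v z) :
    dist z (LTop.ofPoint T.len (.vertex G v)) ≤ 1 - T.coordExt v z := by
  refine LTop.subset_of_forall_ofPoint
    (P := {z | dist z (LTop.ofPoint T.len (.vertex G v)) ≤ 1 - T.coordExt v z})
    (isOpen_lt continuous_const (T.continuous_coordExt v))
    (isClosed_le (by fun_prop) (continuous_const.sub (T.continuous_coordExt v))) (fun x hx => ?_) h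
  rw [Set.mem_ofPred_eq, coordExt_ofPoint] at hx ⊢
  exact T.dist_ofPoint_vertex_le_one_sub_coord hx

theorem dist_vertex_le_of_massExt_pos {z : LTop T.len} {t : V} (h : 0 < T.massExt t z) :
    dist z (LTop.ofPoint T.len (.vertex G t)) ≤ 1 - T.massExt t z + 2 * T.height t := by
  refine LTop.subset_of_forall_ofPoint
    (P := {z | dist z (LTop.ofPoint T.len (.vertex G t)) ≤ 1 - T.massExt t z + 2 * T.height t})
    (isOpen_lt continuous_const (T.continuous_massExt t))
    (isClosed_le (by fun_prop) ((continuous_const.sub (T.continuous_massExt t)).add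
      continuous_const)) (fun x hx => ?_) h
  rw [Set.mem_ofPred_eq, massExt_ofPoint] at hx ⊢
  exact T.dist_ofPoint_vertex_le_of_mass_pos hx

theorem innerOf_of_dist_lt {x y : Point G} {v w : V} (hvw : G.Adj v w)
    (h : dist (LTop.ofPoint T.len x) (LTop.ofPoint T.len y) <
      T.height v / 2 * min (x.coord v) (x.coord w)) : y.InnerOf v w := by
  have hv := half_pos (T.height_pos v)
  have hK := inv_pos.2 hv
  have hLip := T.abs_sub_le_mul_dist (lipschitzWith_min_coord hvw (Real.toNNReal_pos.2 hK).ne'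
    (fun e => (T.len_pos e).le) (by
      rw [Real.coe_toNNReal _ hK.le, ← div_eq_inv_mul, one_le_div hv]
      exact T.half_height_le_len hvw)) x y
  rw [Real.coe_toNNReal _ hK.le, ← div_eq_inv_mul] at hLip
  have hmin := (le_abs_self _).trans_lt (hLip.trans_lt ((div_lt_iff₀' hv).2 h))
  obtain ⟨hyv, hyw⟩ := lt_min_iff.1 ((sub_lt_self_iff _).1 hmin)
  exact Point.innerOf_of_pos hvw.ne hyv hyw

theorem exists_ofPoint_eq_of_coordExt_mem_Ioo {z : LTop T.len} {v : V}
    (h : T.coordExt v z ∈ Set.Ioo 0 1) : ∃ y, LTop.ofPoint T.len y = z := by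
  obtain ⟨η, hη, hη'⟩ := exists_between (lt_min h.1 (sub_pos.2 h.2))
  obtain ⟨hη0, hη1⟩ := lt_min_iff.1 hη'
  let r := T.height v / 4 * η
  have hr0 : 0 < r := by have := T.height_pos v; positivity
  set W := Metric.ball z r ∩ T.coordExt v ⁻¹' Set.Ioo η (1 - η)
  have hW : IsOpen W := Metric.isOpen_ball.inter (isOpen_Ioo.preimage (T.continuous_coordExt v))
  have hzW : z ∈ W := ⟨Metric.mem_ball_self hr0, hη0, by linarith⟩
  obtain ⟨x, hxz, hx⟩ := (LTop.denseRange_ofPoint T.len).exists_mem_open hW ⟨z, hzW⟩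
  rw [Set.mem_preimage, coordExt_ofPoint] at hx
  obtain rfl | ⟨w, hw⟩ := Point.eq_vertex_or_exists_innerOf_of_pos (hη.trans hx.1)
  · rw [Point.vertex_coord_self] at hx
    linarith [hx.2]
  have hinner (y : Point G) (hy : LTop.ofPoint T.len y ∈ W) : y.InnerOf v w := by
    refine T.innerOf_of_dist_lt hw.1.1 (x := x) ?_
    have hmin : η < min (x.coord v) (x.coord w) := lt_min hx.1 (by linarith [hx.2, hw.1.2])
    calc _ ≤ dist (LTop.ofPoint T.len x) z + dist (LTop.ofPoint T.len y) z :=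
          dist_triangle_right _ _ _
      _ < r + r := add_lt_add hxz hy.1
      _ = T.height v / 2 * η := by ring
      _ ≤ _ := by have := T.height_pos v; gcongr
  obtain ⟨y, hy, hyz⟩ := Point.exists_innerOf hw.1.1 h.1 h.2
  refine ⟨y, (dist_le_zero.1 ?_).symm⟩
  have hdist := LTop.subset_of_forall_ofPoint
    (P := {z | dist z (LTop.ofPoint T.len y) ≤ |T.coordExt v z - y.coord v|}) hW
    (isClosed_le (by fun_prop) ((T.continuous_coordExt v).sub continuous_const).abs)
    (fun x' hx' => ?_) hzW
  · rwa [Set.mem_ofPred_eq, hyz, sub_self, abs_zero] at hdist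
  · rw [Set.mem_ofPred_eq, coordExt_ofPoint]
    exact T.dist_ofPoint_le_abs_sub_coord (hinner x' hx').1 hy.1

theorem mass_up_pos_of_dist_lt {x y : Point G} {t : V}
    (h : dist (LTop.ofPoint T.len x) (LTop.ofPoint T.len y) <
      T.height t * Point.mass (T.up t) x) : 0 < Point.mass (T.up t) y := by
  have hLip := T.abs_sub_le_mul_dist (T.lipschitzWith_mass_up t) x y
  rw [Real.coe_toNNReal _ (inv_pos.2 (T.height_pos t)).le, ← div_eq_inv_mul] at hLip
  exact (sub_lt_self_iff _).1 ((le_abs_self _).trans_lt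
    (hLip.trans_lt ((div_lt_iff₀' (T.height_pos t)).2 h)))

theorem mass_up_le_of_dist_lt {x y : Point G} {t c : V} (hc : T.level c = T.level t + 1)
    (hy : y.coord t < Point.mass (T.up t) y)
    (h : dist (LTop.ofPoint T.len x) (LTop.ofPoint T.len y) <
      T.height c * Point.mass (T.up c) x) :
    Point.mass (T.up t) y ≤ y.coord t + Point.mass (T.up c) y := by
  obtain ⟨d, hd, -, hle⟩ := T.exists_child_mass_le hy
  obtain ⟨s, hcs, hds⟩ :=
    T.exists_le_of_mass_pos (T.mass_up_pos_of_dist_lt h) (s := c) (t := d) (by linarith)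
  rwa [T.eq_of_level_eq hcs hds (hc.trans hd.symm)]

theorem exists_child_massExt {z : LTop T.len} {t : V} (ht : 1 ≤ T.massExt t z)
    (hz : T.coordExt t z ≤ 0) :
    ∃ c, T.level c = T.level t + 1 ∧ T.le t c ∧ 1 ≤ T.massExt c z := by
  have hpos := T.height_pos t
  set W := Metric.ball z (T.height t / 8) ∩ {z | T.coordExt t z + 1 / 2 < T.massExt t z}
  have hW : IsOpen W := Metric.isOpen_ball.inter
    (isOpen_lt ((T.continuous_coordExt t).add continuous_const) (T.continuous_massExt t))
  have hzW : z ∈ W := ⟨Metric.mem_ball_self (by positivity), by rw [Set.mem_ofPred_eq]; linarith⟩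
  have hlt (x : Point G) (hx : LTop.ofPoint T.len x ∈ W) :
      x.coord t + 1 / 2 < Point.mass (T.up t) x := by
    rw [← T.coordExt_ofPoint, ← T.massExt_ofPoint]
    exact hx.2
  obtain ⟨x, hx⟩ := (LTop.denseRange_ofPoint T.len).exists_mem_open hW ⟨z, hzW⟩
  obtain ⟨c, hc, htc, hle⟩ := T.exists_child_mass_le (t := t) (x := x) (by linarith [hlt x hx])
  have hheight : T.height c = T.height t / 2 := by
    rw [height, height, hc, pow_succ, mul_one_div]
  have hmass := LTop.subset_of_forall_ofPoint
    (P := {z | T.massExt t z ≤ T.coordExt t z + T.massExt c z}) hW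
    (isClosed_le (T.continuous_massExt t) ((T.continuous_coordExt t).add (T.continuous_massExt c)))
    (fun y hy => ?_) hzW
  · exact ⟨c, hc, htc, by linarith [Set.mem_ofPred_eq ▸ hmass]⟩
  rw [Set.mem_ofPred_eq, massExt_ofPoint, massExt_ofPoint, coordExt_ofPoint]
  refine T.mass_up_le_of_dist_lt hc (x := x) (by linarith [hlt y hy]) ?_
  rw [hheight]
  nlinarith [dist_triangle_right (LTop.ofPoint T.len x) (LTop.ofPoint T.len y) z,
    Metric.mem_ball.1 hx.1, Metric.mem_ball.1 hy.1, hlt x hx]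

theorem one_le_massExt_root (z : LTop T.len) : 1 ≤ T.massExt T.root z := by
  refine LTop.subset_of_forall_ofPoint (P := {z | 1 ≤ T.massExt T.root z}) isOpen_univ
    (isClosed_le continuous_const (T.continuous_massExt _)) (fun x _ => ?_) (Set.mem_univ z)
  rw [Set.mem_ofPred_eq, massExt_ofPoint]
  exact (Point.mass_eq_one fun w _ => T.root_le w).ge

theorem exists_endPoint_eq {z : LTop T.len} (hz : ∀ v, T.coordExt v z ≤ 0) :
    ∃ ω, T.endPoint ω = z := by
  have hstep (t : {t // 1 ≤ T.massExt t z}) : ∃ c : {t // 1 ≤ T.massExt t z},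
      T.level c = T.level t + 1 ∧ T.le t c := by
    obtain ⟨c, hc, htc, hcz⟩ := T.exists_child_massExt t.2 (hz t)
    exact ⟨⟨c, hcz⟩, hc, htc⟩
  choose child hlevel hle using hstep
  let t : ℕ → {t // 1 ≤ T.massExt t z} := fun n => child^[n] ⟨T.root, T.one_le_massExt_root z⟩
  have ht (n : ℕ) : t (n + 1) = child (t n) := Function.iterate_succ_apply' child n _
  have htl (n : ℕ) : T.level (t n) = n := by
    induction n with
    | zero => exact T.level_root
    | succ n ih => rw [ht, hlevel, ih]
  refine ⟨Quotient.mk _ (T.rayOfBranch (fun n => t n) htl fun n => ht n ▸ hle (t n)), ?_⟩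
  refine tendsto_nhds_unique (T.tendsto_endPoint _) (tendsto_iff_dist_tendsto_zero.2 ?_)
  simp only [T.branch_rayOfBranch]
  refine squeeze_zero (fun _ => dist_nonneg) (g := fun n => 2 * (1 / 2 : ℝ) ^ n) (fun n => ?_) ?_
  · have hdist := T.dist_vertex_le_of_massExt_pos (one_pos.trans_le (t n).2)
    rw [height, htl] at hdist
    rw [dist_comm]
    linarith [(t n).2]
  · simpa using (tendsto_pow_atTop_nhds_zero_of_lt_one (by norm_num)
      (by norm_num : (1 / 2 : ℝ) < 1)).const_mul 2

theorem toLTop_surjective : Function.Surjective T.toLTop := by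
  intro z
  by_cases hz : ∀ v, T.coordExt v z ≤ 0
  · obtain ⟨ω, hω⟩ := T.exists_endPoint_eq hz
    exact ⟨.vertexEnd ω, hω⟩
  push Not at hz
  obtain ⟨v, hv⟩ := hz
  rcases lt_or_ge (T.coordExt v z) 1 with hv1 | hv1
  · obtain ⟨y, hy⟩ := T.exists_ofPoint_eq_of_coordExt_mem_Ioo ⟨hv, hv1⟩
    exact ⟨.point y, hy⟩
  · refine ⟨.point (.vertex G v), (dist_le_zero.1 ?_).symm⟩
    exact (T.dist_vertex_le_one_sub_coordExt hv).trans (sub_nonpos.2 hv1)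

theorem homeomorphicOver :
    HomeomorphicOver (LTop.ofPoint T.len) (MTop.point (G := G)) :=
  let h := (Equiv.ofBijective T.toLTop ⟨T.toLTop_injective, T.toLTop_surjective⟩)
    |>.toHomeomorphOfIsInducing T.isInducing_toLTop
  ⟨h.symm, fun x => h.symm_apply_apply (.point x)⟩

end NormalSpanningTree

end GraphCompletion

theorem mainTheorem8 {V : Type*} (G : SimpleGraph V) (hG : G.Connected) :
    (∃ ℓ : G.edgeSet → ℝ, (∀ e, 0 < ℓ e) ∧
      GraphCompletion.HomeomorphicOver
        (GraphCompletion.LTop.ofPoint ℓ) (GraphCompletion.MTop.point (G := G))) ↔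
    TopologicalSpace.MetrizableSpace (GraphCompletion.MTop G) := by
  constructor
  · rintro ⟨ℓ, -, h, -⟩
    have := GraphCompletion.LTop.metrizableSpace ℓ hG
    exact h.symm.isEmbedding.metrizableSpace
  · intro _
    obtain ⟨r, hr⟩ := GraphCompletion.exists_forall_dispersed_le (G := G)
    obtain ⟨T⟩ := GraphCompletion.nonempty_normalSpanningTree hG hr
    exact ⟨T.len, T.len_pos, T.homeomorphicOver⟩
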